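/- Let $n\ge 1$, $m\ge 0$. For a complex discrete-time state-space model $\mathcal M=\{A,B,C,D\}$ with $A\in\mathbb C^{n\times n}$, $B\in\mathbb C^{n\times m}$, $C\in\mathbb C^{m\times n}$, $D\in\mathbb C^{m\times m}$, let $\mathcal T(z)=C(zI-A)^{-1}B+D$. The model is *minimal* if $\operatorname{rank}[\,zI-A\ \ B\,]=n$ and $\operatorname{rank}[\,zI-A^{\mathsf H}\ \ C^{\mathsf H}\,]=n$ for all $z\in\mathbb C$; it is *strictly passive* if all eigenvalues of $A$ lie in the open unit disc and $\mathcal T(e^{i\omega})^{\mathsf H}+\mathcal T(e^{i\omega})>0$ for all $\omega\in[-\pi,\pi]$. For Hermitian $X$ put $$W(X,\mathcal M)=\begin{bmatrix}X-A^{\mathsf H}XA & C^{\mathsf H}-A^{\mathsf H}XB\\ C-B^{\mathsf H}XA & D^{\mathsf H}+D-B^{\mathsf H}XB\end{bmatrix},\qquad \widetilde W(X,\mathcal M)=\begin{bmatrix}X&XA&XB\\A^{\mathsf H}X&X&C^{\mathsf H}\\B^{\mathsf H}X&C&D^{\mathsf H}+D\end{bmatrix}.$$ A model is *normalized* if $W(I,\mathcal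 M)\ge 0$. For a perturbation $\Delta=\begin{bmatrix}\Delta_A&\Delta_B\\ \Delta_C&\Delta_D\end{bmatrix}\in\mathbb C^{(n+m)\times(n+m)}$ let $\mathcal M+\Delta=\{A+\Delta_A,B+\Delta_B,C+\Delta_C,D+\Delta_D\}$, and let $\|\cdot\|$ be either the 2-norm or the Frobenius norm. The *passivity radius* of $\mathcal M$ is $$\rho_{\mathcal M}=\sup_{X>0,\ W(X,\mathcal M)>0}\ \inf\{\|\Delta\| : \det W(X,\mathcal M+\Delta)=0\}\in[0,\infty]$$ (with $\sup\emptyset=0$, $\inf\emptyset=\infty$). For real $\xi<1$ let $$\mathcal M_\xi=\Bigl\{\tfrac{A}{1-\xi},\tfrac{B}{1-\xi},\tfrac{C}{1-\xi},\tfrac{D-\xi I_m}{1-\xi}\Bigr\}$$ with transfer function $\mathcal T_\xi$. **Theorem.** Let $\mathcal M$ be minimal and strictly passive, with $n\ge 1$, and let $$\Xi=\sup\{\xi<1 : \mathcal M_\xi\text{ is strictly passive}\}.$$ Then $\Xi<1$, and for both choices of the norm: 1. $\Xi\le\sup_{\mathcal N}\rho_{\mathcal N}$, where $\mathcal N$ runs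 over all realizations (of any state dimension) of the rational function $\mathcal T(z)$. 2. There is $X>0$ with $\widetilde W(X,\mathcal M_\Xi)\ge 0$. For every such $X$ and every $T\in\mathbb C^{n\times n}$ with $X=T^{\mathsf H}T$, the model $\mathcal M_T=\{TAT^{-1},TB,CT^{-1},D\}$ is a normalized minimal realization of $\mathcal T(z)$ with $\rho_{\mathcal M_T}\ge\Xi$; moreover $\mathcal M_T+\Delta$ is strictly passive for every $\Delta$ with $\|\Delta\|<\Xi$. -/

import Mathlib

open scoped ComplexOrder Matrix ENNReal

noncomputable section

/-- A discrete-time state-space model `x_{k+1} = A x_k + B u_k`, `y_k = C x_k + D u_k` with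
`n` states, `m` inputs and `m` outputs. -/
@[ext]
structure StateSpace (n m : ℕ) where
  A : Matrix (Fin n) (Fin n) ℂ
  B : Matrix (Fin n) (Fin m) ℂ
  C : Matrix (Fin m) (Fin n) ℂ
  D : Matrix (Fin m) (Fin m) ℂ

namespace StateSpace

variable {n m : ℕ}

/-- `(A, B)` is controllable: `rank [z I - A, B] = n` for all complex `z`. -/
def Controllable (A : Matrix (Fin n) (Fin n) ℂ) (B : Matrix (Fin n) (Fin m) ℂ) : Prop :=
  ∀ z : ℂ, (Matrix.fromCols (z • (1 : Matrix (Fin n) (Fin n) ℂ) - A) B).rank = n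

/-- Minimality: `(A, B)` is controllable and `(A, C)` is observable. -/
def IsMinimal (M : StateSpace n m) : Prop :=
  Controllable M.A M.B ∧ Controllable M.Aᴴ M.Cᴴ

/-- The value at `z` of the transfer function `C (z I - A)⁻¹ B + D` (meaningful when `z` is not an
eigenvalue of `A`). -/
def transfer (M : StateSpace n m) (z : ℂ) : Matrix (Fin m) (Fin m) ℂ :=
  M.C * (z • (1 : Matrix (Fin n) (Fin n) ℂ) - M.A)⁻¹ * M.B + M.D

/-- `N` and `M` realize the same rational transfer function: the values agree at every `z` that
is an eigenvalue of neither state matrix (all but finitely many `z`). The state dimensions may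
be different. -/
def SameTransfer {k : ℕ} (N : StateSpace k m) (M : StateSpace n m) : Prop :=
  ∀ z : ℂ, z ∉ spectrum ℂ N.A → z ∉ spectrum ℂ M.A → N.transfer z = M.transfer z

/-- All eigenvalues of `A` lie in the open unit disc. -/
def IsAsymptoticallyStable (M : StateSpace n m) : Prop :=
  ∀ z ∈ spectrum ℂ M.A, ‖z‖ < 1

/-- `Φ(e^{iω}) = T(e^{iω})ᴴ + T(e^{iω})` is positive definite for all `ω ∈ [-π, π]`. -/
def IsStrictlyPositiveReal (M : StateSpace n m) : Prop :=
  ∀ ω ∈ Set.Icc (-Real.pi) Real.pi,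
    ((M.transfer (Complex.exp (ω * Complex.I)))ᴴ
      + M.transfer (Complex.exp (ω * Complex.I))).PosDef

/-- Strict passivity: strictly positive-real and asymptotically stable. -/
def IsStrictlyPassive (M : StateSpace n m) : Prop :=
  M.IsStrictlyPositiveReal ∧ M.IsAsymptoticallyStable

/-- The matrix `W(X, M)` of the passivity linear matrix inequality. -/
def W (X : Matrix (Fin n) (Fin n) ℂ) (M : StateSpace n m) :
    Matrix (Fin n ⊕ Fin m) (Fin n ⊕ Fin m) ℂ :=
  Matrix.fromBlocks
    (X - M.Aᴴ * X * M.A) (M.Cᴴ - M.Aᴴ * X * M.B)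
    (M.C - M.Bᴴ * X * M.A) (M.Dᴴ + M.D - M.Bᴴ * X * M.B)

/-- The matrix `W̃(X, M) = [X, XA, XB; AᴴX, X, Cᴴ; BᴴX, C, Dᴴ + D]`. -/
def Wtilde (X : Matrix (Fin n) (Fin n) ℂ) (M : StateSpace n m) :
    Matrix (Fin n ⊕ (Fin n ⊕ Fin m)) (Fin n ⊕ (Fin n ⊕ Fin m)) ℂ :=
  Matrix.fromBlocks
    X (Matrix.fromCols (X * M.A) (X * M.B))
    (Matrix.fromRows (M.Aᴴ * X) (M.Bᴴ * X))
    (Matrix.fromBlocks X M.Cᴴ M.C (M.Dᴴ + M.D))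

/-- The perturbed model `M + Δ`, where `Δ = [Δ_A, Δ_B; Δ_C, Δ_D]`. -/
def perturb (M : StateSpace n m) (Δ : Matrix (Fin n ⊕ Fin m) (Fin n ⊕ Fin m) ℂ) :
    StateSpace n m where
  A := M.A + Δ.toBlocks₁₁
  B := M.B + Δ.toBlocks₁₂
  C := M.C + Δ.toBlocks₂₁
  D := M.D + Δ.toBlocks₂₂

/-- The two norms in which perturbations are measured. -/
inductive PerturbationNorm where
  | spectral
  | frobenius

/-- The 2-norm (largest singular value), respectively the Frobenius norm, of a perturbation. -/
def PerturbationNorm.size (ν : PerturbationNorm)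
    (Δ : Matrix (Fin n ⊕ Fin m) (Fin n ⊕ Fin m) ℂ) : ℝ :=
  match ν with
  | .spectral => ‖Matrix.toEuclideanCLM (n := Fin n ⊕ Fin m) (𝕜 := ℂ) Δ‖
  | .frobenius => Real.sqrt (∑ i, ∑ j, ‖Δ i j‖ ^ 2)

/-- The `X`-passivity radius `inf { ‖Δ‖ | det W(X, M + Δ) = 0 }`. -/
def XPassivityRadius (ν : PerturbationNorm) (M : StateSpace n m)
    (X : Matrix (Fin n) (Fin n) ℂ) : ℝ≥0∞ :=
  ⨅ (Δ : Matrix (Fin n ⊕ Fin m) (Fin n ⊕ Fin m) ℂ) (_ : (W X (M.perturb Δ)).det = 0),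
    ENNReal.ofReal (ν.size Δ)

/-- The passivity radius: the supremum of the `X`-passivity radius over all `X > 0` with
`W(X, M) > 0`. -/
def passivityRadius (ν : PerturbationNorm) (M : StateSpace n m) : ℝ≥0∞ :=
  ⨆ (X : Matrix (Fin n) (Fin n) ℂ) (_ : X.PosDef ∧ (W X M).PosDef), M.XPassivityRadius ν X

/-- The shifted model `{A/(1-ξ), B/(1-ξ), C/(1-ξ), (D - ξ I)/(1-ξ)}` (meaningful for `ξ ≠ 1`). -/
def shift (M : StateSpace n m) (ξ : ℝ) : StateSpace n m where
  A := (1 - ξ : ℂ)⁻¹ • M.A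
  B := (1 - ξ : ℂ)⁻¹ • M.B
  C := (1 - ξ : ℂ)⁻¹ • M.C
  D := (1 - ξ : ℂ)⁻¹ • (M.D - (ξ : ℂ) • (1 : Matrix (Fin m) (Fin m) ℂ))

/-- `Ξ`, the supremum of the shifts `ξ < 1` for which the shifted model is strictly passive. -/
def maxShift (M : StateSpace n m) : ℝ :=
  sSup {ξ : ℝ | ξ < 1 ∧ (M.shift ξ).IsStrictlyPassive}

/-- The transformed realization `{T A T⁻¹, T B, C T⁻¹, D}`. -/
def transform (M : StateSpace n m) (T : Matrix (Fin n) (Fin n) ℂ) : StateSpace n m where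
  A := T * M.A * T⁻¹
  B := T * M.B
  C := M.C * T⁻¹
  D := M.D

/-- Normalized passive model: `[I, Cᴴ; C, Dᴴ + D] - [A, B]ᴴ [A, B] ≥ 0`. -/
def IsNormalized (M : StateSpace n m) : Prop :=
  (Matrix.fromBlocks 1 M.Cᴴ M.C (M.Dᴴ + M.D)
    - (Matrix.fromCols M.A M.B)ᴴ * Matrix.fromCols M.A M.B).PosSemidef

end StateSpace

end

/-! Unlike `W`, the matrix `Wtilde` is affine in the model, and (1-ξ) W̃(X, M_ξ) = W̃(X, M) - ξ
diag(X, X, 2I). A shift of the model is therefore a margin in the matrix inequality. In coordinates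
where X = TᴴT becomes I, this margin reads W̃(I, M_T) ≥ ξ diag(I, I, 2I). A perturbation Δ adds 2 Re
(x,u)ᴴ Δ (y,u) to the form at (x, y, u), and this is at most ‖Δ‖ (|x|² + |y|² + 2|u|²) in absolute
value. So ‖Δ‖ < ξ leaves W̃(I, M_T + Δ) > 0, which makes W(I, M_T + Δ) positive definite, hence
nonsingular, and M_T + Δ strictly passive (`Wtilde_perturb_posDef`, `isStrictlyPassive_of_W`).

It remains to find X at ξ = Ξ. For strictly passive M_ξ the strict KYP lemma `exists_W_posDef` gives
a solution: otherwise Hahn–Banach yields a dual certificate Z ≥ 0, which splits into rank-one terms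
supported at single frequencies on the unit circle, where strict positive realness and stability
force Z = 0. Controllability bounds all solutions X, so the pairs (ξ, X) with ξ in [0, 1] form a
compact set and the supremum is attained. Observability makes X definite and excludes ξ = 1. -/

namespace StateSpace

open Matrix

/-! ### Quadratic forms of `W` and `Wtilde` -/

section Forms

variable {n m : ℕ}

lemma dotProduct_conjTranspose_mulVec {ι κ : Type*} [Fintype ι] [Fintype κ] (A : Matrix ι κ ℂ)
    (y : κ → ℂ) (x : ι → ℂ) : star y ⬝ᵥ Aᴴ *ᵥ x = star (A *ᵥ y) ⬝ᵥ x := by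
  rw [dotProduct_mulVec, star_mulVec]

/-- The quadratic form of `W(X, M)`. -/
lemma W_form (M : StateSpace n m) (X : Matrix (Fin n) (Fin n) ℂ) (y : Fin n → ℂ) (u : Fin m → ℂ) :
    star (Sum.elim y u) ⬝ᵥ W X M *ᵥ Sum.elim y u =
      star y ⬝ᵥ X *ᵥ y - star (M.A *ᵥ y + M.B *ᵥ u) ⬝ᵥ X *ᵥ (M.A *ᵥ y + M.B *ᵥ u)
      + star u ⬝ᵥ (M.C *ᵥ y + M.D *ᵥ u) + star (M.C *ᵥ y + M.D *ᵥ u) ⬝ᵥ u := by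
  have h : star (Sum.elim y u) = Sum.elim (star y) (star u) := by
    ext (i | i) <;> rfl
  simp only [W, fromBlocks_mulVec, h, sumElim_dotProduct_sumElim, sub_mulVec, add_mulVec,
    dotProduct_add, dotProduct_sub, star_add, add_dotProduct, mulVec_add,
    Sum.elim_comp_inl, Sum.elim_comp_inr, ← mulVec_mulVec, dotProduct_conjTranspose_mulVec]
  ring

/-- The quadratic form of `W̃(X, M)` by completion of the square. -/
lemma Wtilde_form (M : StateSpace n m) (X : Matrix (Fin n) (Fin n) ℂ) (x y : Fin n → ℂ)
    (u : Fin m → ℂ) :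
    star (Sum.elim x (Sum.elim y u)) ⬝ᵥ Wtilde X M *ᵥ Sum.elim x (Sum.elim y u) =
      star (x + (M.A *ᵥ y + M.B *ᵥ u)) ⬝ᵥ X *ᵥ (x + (M.A *ᵥ y + M.B *ᵥ u)) +
      star (Sum.elim y u) ⬝ᵥ W X M *ᵥ Sum.elim y u := by
  rw [W_form]
  have h1 : star (Sum.elim y u) = Sum.elim (star y) (star u) := by
    ext (i | i) <;> rfl
  have h : star (Sum.elim x (Sum.elim y u)) = Sum.elim (star x) (Sum.elim (star y) (star u)) := by
    ext (i | i | i) <;> rfl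
  simp only [Wtilde, fromBlocks_mulVec, h, sumElim_dotProduct_sumElim, add_mulVec,
    fromCols_mulVec, fromRows_mulVec, Sum.elim_add_add,
    dotProduct_add, star_add, add_dotProduct, mulVec_add,
    Sum.elim_comp_inl, Sum.elim_comp_inr, ← mulVec_mulVec, dotProduct_conjTranspose_mulVec]
  ring

end Forms

/-! ### The matrix inequality under shift, change of coordinates and perturbation -/

section LMI

variable {n m : ℕ}

lemma fromBlocks_sub_fromBlocks {ι κ ι' κ' R : Type*} [AddGroup R] (A A' : Matrix ι ι' R)
    (B B' : Matrix ι κ' R) (C C' : Matrix κ ι' R) (D D' : Matrix κ κ' R) :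
    fromBlocks A B C D - fromBlocks A' B' C' D' =
      fromBlocks (A - A') (B - B') (C - C') (D - D') := by
  ext (i | i) (j | j) <;> rfl

lemma W_isHermitian (M : StateSpace n m) {X : Matrix (Fin n) (Fin n) ℂ} (hX : X.IsHermitian) :
    (W X M).IsHermitian := by
  have hX' : Xᴴ = X := hX
  rw [W, isHermitian_fromBlocks_iff]
  refine ⟨?_, ?_, ?_, ?_⟩
  · simp [IsHermitian, hX', Matrix.mul_assoc]
  · simp [hX', Matrix.mul_assoc]
  · simp [hX', Matrix.mul_assoc]
  · simp [IsHermitian, hX', Matrix.mul_assoc, add_comm]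

lemma Wtilde_isHermitian (M : StateSpace n m) {X : Matrix (Fin n) (Fin n) ℂ}
    (hX : X.IsHermitian) : (Wtilde X M).IsHermitian := by
  have hX' : Xᴴ = X := hX
  rw [Wtilde, isHermitian_fromBlocks_iff, isHermitian_fromBlocks_iff]
  refine ⟨hX, ?_, ?_, hX, ?_, ?_, ?_⟩ <;>
  simp [IsHermitian, hX', conjTranspose_fromCols_eq_fromRows_conjTranspose,
    conjTranspose_fromRows_eq_fromCols_conjTranspose, add_comm]

lemma isHermitian_of_Wtilde {M : StateSpace n m} {X : Matrix (Fin n) (Fin n) ℂ}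
    (h : (Wtilde X M).IsHermitian) : X.IsHermitian :=
  (isHermitian_fromBlocks_iff.1 h).1

lemma Wtilde_form_zero (M : StateSpace n m) (X : Matrix (Fin n) (Fin n) ℂ) (x : Fin n → ℂ) :
    star (Sum.elim x (Sum.elim (0 : Fin n → ℂ) (0 : Fin m → ℂ))) ⬝ᵥ Wtilde X M *ᵥ
      Sum.elim x (Sum.elim (0 : Fin n → ℂ) (0 : Fin m → ℂ)) = star x ⬝ᵥ X *ᵥ x := by
  rw [Wtilde_form, W_form]
  simp

/-- The choice x = -(Ay + Bu) kills the completed square. This gives the Schur complement argument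
without inverting X, so it also serves for singular X. -/
lemma Wtilde_form_neg (M : StateSpace n m) (X : Matrix (Fin n) (Fin n) ℂ) (y : Fin n → ℂ)
    (u : Fin m → ℂ) :
    star (Sum.elim (-(M.A *ᵥ y + M.B *ᵥ u)) (Sum.elim y u)) ⬝ᵥ Wtilde X M *ᵥ
      Sum.elim (-(M.A *ᵥ y + M.B *ᵥ u)) (Sum.elim y u) =
      star (Sum.elim y u) ⬝ᵥ W X M *ᵥ Sum.elim y u := by
  rw [Wtilde_form]
  simp

lemma Wtilde_posSemidef {M : StateSpace n m} {X : Matrix (Fin n) (Fin n) ℂ}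
    (hX : X.PosSemidef) (hW : (W X M).PosSemidef) : (Wtilde X M).PosSemidef := by
  refine .of_dotProduct_mulVec_nonneg (Wtilde_isHermitian M hX.1) fun w => ?_
  rw [← Sum.elim_comp_inl_inr w, ← Sum.elim_comp_inl_inr (w ∘ Sum.inr), Wtilde_form]
  exact add_nonneg (hX.dotProduct_mulVec_nonneg _) (hW.dotProduct_mulVec_nonneg _)

lemma posSemidef_of_Wtilde {M : StateSpace n m} {X : Matrix (Fin n) (Fin n) ℂ}
    (h : (Wtilde X M).PosSemidef) : X.PosSemidef ∧ (W X M).PosSemidef := by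
  have hX := isHermitian_of_Wtilde h.1
  refine ⟨.of_dotProduct_mulVec_nonneg hX fun x => ?_,
    .of_dotProduct_mulVec_nonneg (W_isHermitian M hX) fun w => ?_⟩
  · rw [← Wtilde_form_zero M]
    exact h.dotProduct_mulVec_nonneg _
  · rw [← Sum.elim_comp_inl_inr w, ← Wtilde_form_neg]
    exact h.dotProduct_mulVec_nonneg _

lemma posDef_of_Wtilde {M : StateSpace n m} {X : Matrix (Fin n) (Fin n) ℂ}
    (h : (Wtilde X M).PosDef) : X.PosDef ∧ (W X M).PosDef := by
  have hX := isHermitian_of_Wtilde h.1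
  refine ⟨.of_dotProduct_mulVec_pos hX fun x hx => ?_,
    .of_dotProduct_mulVec_pos (W_isHermitian M hX) fun w hw => ?_⟩
  · rw [← Wtilde_form_zero M]
    refine h.dotProduct_mulVec_pos fun h0 => hx ?_
    ext i
    exact congrFun h0 (Sum.inl i)
  · rw [← Sum.elim_comp_inl_inr w, ← Wtilde_form_neg]
    refine h.dotProduct_mulVec_pos fun h0 => hw ?_
    ext i
    have := congrFun h0 (Sum.inr i)
    rcases i with i | i <;> exact this

/-- The weight `diag(X, X, 2I)`. -/
def weight (m : ℕ) (X : Matrix (Fin n) (Fin n) ℂ) :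
    Matrix (Fin n ⊕ (Fin n ⊕ Fin m)) (Fin n ⊕ (Fin n ⊕ Fin m)) ℂ :=
  Matrix.fromBlocks X 0 0 (Matrix.fromBlocks X 0 0 ((2 : ℂ) • 1))

/-- The factor 1-ξ cancels the scaling of A, B, C; it turns the two diagonal blocks X into X - ξX,
and D - ξI together with its adjoint contributes -2ξI. Hence the 2 in `weight`. -/
lemma smul_Wtilde_shift (M : StateSpace n m) (X : Matrix (Fin n) (Fin n) ℂ) {ξ : ℝ}
    (hξ : ξ ≠ 1) :
    (1 - ξ : ℂ) • Wtilde X (M.shift ξ) = Wtilde X M - (ξ : ℂ) • weight m X := by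
  have h : (1 - ξ : ℂ) ≠ 0 := sub_ne_zero.2 fun h => hξ (by exact_mod_cast h.symm)
  have hs : star (1 - ξ : ℂ)⁻¹ = (1 - ξ : ℂ)⁻¹ := by simp
  have hs' : star (ξ : ℂ) = ξ := by simp
  rw [Wtilde, Wtilde, weight, fromBlocks_smul, fromBlocks_smul, fromBlocks_smul, fromBlocks_smul,
    fromBlocks_sub_fromBlocks, fromBlocks_sub_fromBlocks]
  have h1 : (1 - ξ : ℂ) • X = X - (ξ : ℂ) • X := by rw [sub_smul, one_smul]
  have key : ∀ {ι κ : Type} (Y : Matrix ι κ ℂ), (1 - ξ : ℂ) • (1 - ξ : ℂ)⁻¹ • Y = Y :=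
    fun Y => smul_inv_smul₀ h Y
  congr 1
  · have hc : ∀ (P : Matrix (Fin n) (Fin n) ℂ) (Q : Matrix (Fin n) (Fin m) ℂ),
        (1 - ξ : ℂ) • fromCols P Q = fromCols ((1 - ξ : ℂ) • P) ((1 - ξ : ℂ) • Q) := by
      intro P Q
      ext i (j | j) <;> rfl
    rw [hc]
    simp [shift, key]
  · have hr : ∀ (P : Matrix (Fin n) (Fin n) ℂ) (Q : Matrix (Fin m) (Fin n) ℂ),
        (1 - ξ : ℂ) • fromRows P Q = fromRows ((1 - ξ : ℂ) • P) ((1 - ξ : ℂ) • Q) := by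
      intro P Q
      ext (i | i) j <;> rfl
    rw [hr]
    simp only [shift, conjTranspose_smul, hs, Matrix.smul_mul, key]
    simp
  · congr 1
    · simp only [shift, conjTranspose_smul, hs, key]
      simp
    · simp only [shift, key]
      simp
    · simp only [shift, conjTranspose_smul, hs, smul_add, key, conjTranspose_sub, hs',
        conjTranspose_one]
      rw [smul_smul, mul_comm, mul_smul, two_smul]
      abel

lemma weight_form (X : Matrix (Fin n) (Fin n) ℂ) (x y : Fin n → ℂ) (u : Fin m → ℂ) :
    star (Sum.elim x (Sum.elim y u)) ⬝ᵥ weight m X *ᵥ Sum.elim x (Sum.elim y u) =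
      star x ⬝ᵥ X *ᵥ x + star y ⬝ᵥ X *ᵥ y + 2 * (star u ⬝ᵥ u) := by
  have h : star (Sum.elim x (Sum.elim y u)) = Sum.elim (star x) (Sum.elim (star y) (star u)) := by
    ext (i | i | i) <;> rfl
  simp only [weight, fromBlocks_mulVec, h, sumElim_dotProduct_sumElim,
    Sum.elim_comp_inl, Sum.elim_comp_inr, smul_mulVec, one_mulVec, zero_mulVec, add_zero, zero_add,
    dotProduct_smul, smul_eq_mul]
  ring

lemma weight_posSemidef {X : Matrix (Fin n) (Fin n) ℂ} (hX : X.PosSemidef) :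
    (weight m X).PosSemidef := by
  refine .of_dotProduct_mulVec_nonneg ?_ fun w => ?_
  · rw [weight, isHermitian_fromBlocks_iff, isHermitian_fromBlocks_iff]
    simp [hX.1.eq, IsHermitian, conjTranspose_smul]
  · rw [← Sum.elim_comp_inl_inr w, ← Sum.elim_comp_inl_inr (w ∘ Sum.inr), weight_form]
    refine add_nonneg (add_nonneg (hX.dotProduct_mulVec_nonneg _) (hX.dotProduct_mulVec_nonneg _))
      (mul_nonneg (by norm_num) (dotProduct_star_self_nonneg _))

/-- Change of state coordinates turns the form of `W̃(TᴴT, M)` into that of `W̃(I, M_T)`. -/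
lemma Wtilde_transform_form (M : StateSpace n m) {T : Matrix (Fin n) (Fin n) ℂ} (hT : IsUnit T.det)
    (x y : Fin n → ℂ) (u : Fin m → ℂ) :
    star (Sum.elim x (Sum.elim y u)) ⬝ᵥ Wtilde (Tᴴ * T) M *ᵥ Sum.elim x (Sum.elim y u) =
      star (Sum.elim (T *ᵥ x) (Sum.elim (T *ᵥ y) u)) ⬝ᵥ Wtilde 1 (M.transform T) *ᵥ
        Sum.elim (T *ᵥ x) (Sum.elim (T *ᵥ y) u) := by
  have e : T⁻¹ *ᵥ T *ᵥ y = y := by rw [mulVec_mulVec, nonsing_inv_mul _ hT, one_mulVec]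
  rw [Wtilde_form, Wtilde_form, W_form, W_form]
  simp only [transform, ← mulVec_mulVec, dotProduct_conjTranspose_mulVec, e, ← mulVec_add,
    one_mulVec]

/-- At X = I the model enters only through the pairing of (x, u) with (Ay + Bu, Cy + Du) and its
conjugate, with no quadratic term in the model. -/
lemma Wtilde_perturb_form (M : StateSpace n m) (Δ : Matrix (Fin n ⊕ Fin m) (Fin n ⊕ Fin m) ℂ)
    (x y : Fin n → ℂ) (u : Fin m → ℂ) :
    star (Sum.elim x (Sum.elim y u)) ⬝ᵥ Wtilde 1 (M.perturb Δ) *ᵥ Sum.elim x (Sum.elim y u) =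
      star (Sum.elim x (Sum.elim y u)) ⬝ᵥ Wtilde 1 M *ᵥ Sum.elim x (Sum.elim y u) +
      (star (Sum.elim x u) ⬝ᵥ Δ *ᵥ Sum.elim y u + star (Δ *ᵥ Sum.elim y u) ⬝ᵥ Sum.elim x u) := by
  have h : ∀ {a b : ℕ} (y : Fin a → ℂ) (u : Fin b → ℂ),
      star (Sum.elim y u) = Sum.elim (star y) (star u) := by
    intro a b y u
    ext (i | i) <;> rfl
  rw [Wtilde_form, Wtilde_form, W_form, W_form]
  conv_rhs => rw [← fromBlocks_toBlocks Δ]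
  simp only [perturb, fromBlocks_mulVec, h, sumElim_dotProduct_sumElim,
    Sum.elim_comp_inl, Sum.elim_comp_inr, one_mulVec, add_mulVec, star_add, add_dotProduct,
    dotProduct_add]
  ring

lemma isNormalized_of_W {M : StateSpace n m} (h : (W 1 M).PosSemidef) : M.IsNormalized := by
  have e : Matrix.fromBlocks 1 M.Cᴴ M.C (M.Dᴴ + M.D)
      - (Matrix.fromCols M.A M.B)ᴴ * Matrix.fromCols M.A M.B = W 1 M := by
    rw [conjTranspose_fromCols_eq_fromRows_conjTranspose, fromRows_mul_fromCols, fromBlocks_sub_fromBlocks, W]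
    simp
  rw [IsNormalized, e]
  exact h

end LMI

/-! ### Controllability and observability -/

section Minimality

variable {n m : ℕ}

/-- The Popov–Belevitch–Hautus eigenvector form of controllability. -/
lemma controllable_iff {A : Matrix (Fin n) (Fin n) ℂ} {B : Matrix (Fin n) (Fin m) ℂ} :
    Controllable A B ↔ ∀ (z : ℂ) (w : Fin n → ℂ), w ᵥ* A = z • w → w ᵥ* B = 0 → w = 0 := by
  refine forall_congr' fun z => ?_
  -- Rank n means independent rows, that is, injective left multiplication.
  have h1 : (fromCols (z • (1 : Matrix (Fin n) (Fin n) ℂ) - A) B).rank = n ↔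
      Function.Injective (fun w => w ᵥ* fromCols (z • (1 : Matrix (Fin n) (Fin n) ℂ) - A) B) := by
    rw [vecMul_injective_iff, linearIndependent_iff_card_eq_finrank_span, Fintype.card_fin,
      rank_eq_finrank_span_row, eq_comm]
    rfl
  rw [h1]
  have h2 : ∀ w, w ᵥ* fromCols (z • (1 : Matrix (Fin n) (Fin n) ℂ) - A) B = 0 ↔
      w ᵥ* A = z • w ∧ w ᵥ* B = 0 := by
    intro w
    rw [vecMul_fromCols, vecMul_sub, vecMul_smul, vecMul_one]
    constructor
    · intro h
      refine ⟨?_, funext fun i => congrFun h (Sum.inr i)⟩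
      ext i
      have := congrFun h (Sum.inl i)
      simp only [Sum.elim_inl, Pi.sub_apply, Pi.zero_apply] at this
      exact (sub_eq_zero.1 this).symm
    · rintro ⟨h, h'⟩
      rw [h, h', sub_self]
      ext (i | i) <;> rfl
  constructor
  · intro h w hA hB
    exact h (((h2 w).2 ⟨hA, hB⟩).trans (zero_vecMul _).symm)
  · intro h v w hvw
    have : (v - w) ᵥ* fromCols (z • (1 : Matrix (Fin n) (Fin n) ℂ) - A) B = 0 := by
      rw [sub_vecMul]
      exact sub_eq_zero.2 hvw
    obtain ⟨a, b⟩ := (h2 _).1 this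
    exact sub_eq_zero.1 (h _ a b)

/-- Conjugation turns left eigenvectors of Aᴴ into right eigenvectors of A, with the eigenvalue
conjugated as well. -/
lemma observable_iff {A : Matrix (Fin n) (Fin n) ℂ} {C : Matrix (Fin m) (Fin n) ℂ} :
    Controllable Aᴴ Cᴴ ↔ ∀ (z : ℂ) (v : Fin n → ℂ), A *ᵥ v = z • v → C *ᵥ v = 0 → v = 0 := by
  rw [controllable_iff]
  have key : ∀ {k : ℕ} (P : Matrix (Fin k) (Fin n) ℂ) (v : Fin n → ℂ),
      v ᵥ* Pᴴ = star (P *ᵥ star v) := by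
    intro k P v
    rw [star_mulVec, star_star]
  constructor
  · intro h z v hA hC
    have := h (star z) (star v) (by rw [key, star_star, hA, star_smul])
      (by rw [key, star_star, hC, star_zero])
    exact star_eq_zero.1 this
  · intro h z v hA hC
    rw [key] at hA hC
    have := h (star z) (star v) (by rw [← star_smul, ← hA, star_star]) (star_eq_zero.1 hC)
    exact star_eq_zero.1 this

lemma isMinimal_transform {M : StateSpace n m} (h : M.IsMinimal) {T : Matrix (Fin n) (Fin n) ℂ}
    (hT : IsUnit T.det) : (M.transform T).IsMinimal := by
  obtain ⟨hc, ho⟩ := h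
  rw [controllable_iff] at hc
  rw [observable_iff] at ho
  refine ⟨controllable_iff.2 fun z w hA hB => ?_, observable_iff.2 fun z v hA hC => ?_⟩
  · have h0 : w ᵥ* T = 0 := by
      refine hc z _ ?_ ?_
      · have := congrArg (· ᵥ* T) hA
        simp only [transform, smul_vecMul, vecMul_vecMul, Matrix.mul_assoc,
          nonsing_inv_mul _ hT, Matrix.mul_one] at this
        simpa [vecMul_vecMul] using this
      · simpa [transform, vecMul_vecMul] using hB
    have := congrArg (· ᵥ* T⁻¹) h0
    simpa [vecMul_vecMul, mul_nonsing_inv _ hT] using this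
  · have h0 : T⁻¹ *ᵥ v = 0 := by
      refine ho z _ ?_ ?_
      · have := congrArg (T⁻¹ *ᵥ ·) hA
        simp only [transform, mulVec_smul, mulVec_mulVec, ← Matrix.mul_assoc,
          nonsing_inv_mul _ hT, Matrix.one_mul] at this
        simpa [mulVec_mulVec] using this
      · simpa [transform, mulVec_mulVec] using hC
    have := congrArg (T *ᵥ ·) h0
    simpa [mulVec_mulVec, mul_nonsing_inv _ hT] using this

lemma transfer_transform (M : StateSpace n m) {T : Matrix (Fin n) (Fin n) ℂ}
    (hT : IsUnit T.det) (z : ℂ) : (M.transform T).transfer z = M.transfer z := by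
  have e : z • (1 : Matrix (Fin n) (Fin n) ℂ) - T * M.A * T⁻¹ =
      T * (z • (1 : Matrix (Fin n) (Fin n) ℂ) - M.A) * T⁻¹ := by
    rw [Matrix.mul_sub, Matrix.sub_mul]
    simp [mul_nonsing_inv _ hT]
  simp only [transfer, transform, e]
  rw [Matrix.mul_inv_rev, Matrix.mul_inv_rev, nonsing_inv_nonsing_inv _ hT]
  simp only [Matrix.mul_assoc, nonsing_inv_mul_cancel_left _ _ hT]

/-- For a controllable pair, an invariant subspace containing the range of `B` is everything. -/
lemma Controllable.eq_top {A : Matrix (Fin n) (Fin n) ℂ} {B : Matrix (Fin n) (Fin m) ℂ}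
    (h : Controllable A B) {S : Submodule ℂ (Fin n → ℂ)} (hA : ∀ v ∈ S, A *ᵥ v ∈ S)
    (hB : ∀ u, B *ᵥ u ∈ S) : S = ⊤ := by
  rw [controllable_iff] at h
  -- The annihilator of S for the bilinear pairing is invariant under w ↦ wA and kills the range of
  -- B. If nonzero it contains a left eigenvector of A, against the eigenvector test.
  let R : Submodule ℂ (Fin n → ℂ) :=
    { carrier := {w | ∀ v ∈ S, w ⬝ᵥ v = 0}
      add_mem' := fun ha hb v hv => by rw [add_dotProduct, ha v hv, hb v hv, add_zero]
      zero_mem' := fun v _ => zero_dotProduct v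
      smul_mem' := fun c w hw v hv => by rw [smul_dotProduct, hw v hv, smul_zero] }
  have hR : ∀ w ∈ R, A.vecMulLinear w ∈ R := fun w hw v hv => by
    rw [vecMulLinear_apply, ← dotProduct_mulVec]
    exact hw _ (hA v hv)
  have hbot : R = ⊥ := by
    by_contra hne
    have : Nontrivial R := Submodule.nontrivial_iff_ne_bot.2 hne
    obtain ⟨z, hz⟩ := Module.End.exists_eigenvalue (A.vecMulLinear.restrict hR)
    obtain ⟨w, hw⟩ := hz.exists_hasEigenvector
    have hw1 : (w : Fin n → ℂ) ᵥ* A = z • (w : Fin n → ℂ) :=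
      congrArg Subtype.val hw.apply_eq_smul
    refine hw.2 (Subtype.ext (h z w hw1 ?_))
    refine dotProduct_eq_zero _ fun u => ?_
    rw [← dotProduct_mulVec]
    exact w.2 _ (hB u)
  by_contra hne
  -- A nonzero functional vanishing on a proper S is given by a nonzero row vector in R.
  obtain ⟨f, hf0, hf⟩ := Submodule.exists_le_ker_of_lt_top S (lt_top_iff_ne_top.2 hne)
  have hrep : ∀ v, f v = (fun i => f (Pi.single i 1)) ⬝ᵥ v := by
    intro v
    conv_lhs => rw [pi_eq_sum_univ' v]
    simp [dotProduct, mul_comm]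
  have : (fun i => f (Pi.single i 1)) ∈ R := fun v hv => by
    rw [← hrep]
    exact hf hv
  rw [hbot, Submodule.mem_bot] at this
  refine hf0 (LinearMap.ext fun v => ?_)
  rw [hrep, this, zero_dotProduct, LinearMap.zero_apply]

/-- For an observable pair, an invariant subspace of the kernel of `C` is trivial. -/
lemma observable_eq_bot {A : Matrix (Fin n) (Fin n) ℂ} {C : Matrix (Fin m) (Fin n) ℂ}
    (h : Controllable Aᴴ Cᴴ) {S : Submodule ℂ (Fin n → ℂ)} (hA : ∀ v ∈ S, A *ᵥ v ∈ S)
    (hC : ∀ v ∈ S, C *ᵥ v = 0) : S = ⊥ := by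
  rw [observable_iff] at h
  by_contra hne
  have : Nontrivial S := Submodule.nontrivial_iff_ne_bot.2 hne
  obtain ⟨z, hz⟩ := Module.End.exists_eigenvalue (A.mulVecLin.restrict hA)
  obtain ⟨w, hw⟩ := hz.exists_hasEigenvector
  have hw1 : A *ᵥ (w : Fin n → ℂ) = z • (w : Fin n → ℂ) :=
    congrArg Subtype.val hw.apply_eq_smul
  exact hw.2 (Subtype.ext (h z w hw1 (hC _ w.2)))

end Minimality

/-! ### Norm bounds, robustness of the inequality, and passivity from a solution -/

section Passivity

variable {n m : ℕ}

lemma norm_form_le_spectral {ι : Type*} [Fintype ι] [DecidableEq ι] (Δ : Matrix ι ι ℂ)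
    (a b : ι → ℂ) : ‖star a ⬝ᵥ Δ *ᵥ b‖ ≤
      ‖Matrix.toEuclideanCLM (n := ι) (𝕜 := ℂ) Δ‖ *
        (‖WithLp.toLp 2 a‖ * ‖WithLp.toLp 2 b‖) := by
  have h : star a ⬝ᵥ Δ *ᵥ b =
      inner ℂ (WithLp.toLp 2 a) (Matrix.toEuclideanCLM (n := ι) (𝕜 := ℂ) Δ (WithLp.toLp 2 b)) := by
    rw [EuclideanSpace.inner_eq_star_dotProduct, dotProduct_comm]
    rfl
  rw [h]
  refine (norm_inner_le_norm _ _).trans ?_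
  have := (Matrix.toEuclideanCLM (n := ι) (𝕜 := ℂ) Δ).le_opNorm (WithLp.toLp 2 b)
  nlinarith [norm_nonneg (WithLp.toLp 2 a)]

/-- Cauchy–Schwarz in each row. With it, the bilinear bound for the 2-norm serves both norms. -/
lemma norm_toEuclideanCLM_le_frobenius {ι : Type*} [Fintype ι] [DecidableEq ι]
    (Δ : Matrix ι ι ℂ) : ‖Matrix.toEuclideanCLM (n := ι) (𝕜 := ℂ) Δ‖ ≤
      Real.sqrt (∑ i, ∑ j, ‖Δ i j‖ ^ 2) := by
  refine ContinuousLinearMap.opNorm_le_bound _ (Real.sqrt_nonneg _) fun b => ?_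
  rw [EuclideanSpace.norm_eq, EuclideanSpace.norm_eq, ← Real.sqrt_mul (by positivity)]
  refine Real.sqrt_le_sqrt ?_
  rw [Finset.sum_mul]
  refine Finset.sum_le_sum fun i _ => ?_
  have h : (Matrix.toEuclideanCLM (n := ι) (𝕜 := ℂ) Δ b) i = ∑ j, Δ i j * b j := rfl
  rw [h]
  calc ‖∑ j, Δ i j * b j‖ ^ 2 ≤ (∑ j, ‖Δ i j‖ * ‖b j‖) ^ 2 := by
        gcongr
        exact (norm_sum_le _ _).trans_eq (by simp)
    _ ≤ _ := Finset.sum_mul_sq_le_sq_mul_sq _ _ _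

lemma norm_form_le_size (ν : PerturbationNorm) (Δ : Matrix (Fin n ⊕ Fin m) (Fin n ⊕ Fin m) ℂ)
    (a b : Fin n ⊕ Fin m → ℂ) : ‖star a ⬝ᵥ Δ *ᵥ b‖ ≤
      ν.size Δ * (‖WithLp.toLp 2 a‖ * ‖WithLp.toLp 2 b‖) := by
  refine (norm_form_le_spectral Δ a b).trans ?_
  cases ν
  · exact le_rfl
  · exact mul_le_mul_of_nonneg_right (norm_toEuclideanCLM_le_frobenius Δ) (by positivity)

lemma PerturbationNorm.size_nonneg (ν : PerturbationNorm)
    (Δ : Matrix (Fin n ⊕ Fin m) (Fin n ⊕ Fin m) ℂ) : 0 ≤ ν.size Δ := by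
  cases ν
  · exact norm_nonneg _
  · exact Real.sqrt_nonneg _

lemma star_dotProduct_self_eq {ι : Type*} [Fintype ι] (a : ι → ℂ) :
    star a ⬝ᵥ a = ((‖WithLp.toLp 2 a‖ ^ 2 : ℝ) : ℂ) := by
  have h := EuclideanSpace.inner_eq_star_dotProduct (𝕜 := ℂ) (WithLp.toLp 2 a) (WithLp.toLp 2 a)
  rw [inner_self_eq_norm_sq_to_K, dotProduct_comm] at h
  rw [← h]
  simp

/-- If `W̃(I, M) - ξ diag(I, I, 2I) ≥ 0`, then `W̃(I, M + Δ) > 0` for all `Δ` of size below `ξ`. -/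
lemma Wtilde_perturb_posDef {M : StateSpace n m} {ξ : ℝ}
    (h : (Wtilde 1 M - (ξ : ℂ) • weight m 1).PosSemidef) (ν : PerturbationNorm)
    {Δ : Matrix (Fin n ⊕ Fin m) (Fin n ⊕ Fin m) ℂ} (hΔ : ν.size Δ < ξ) :
    (Wtilde 1 (M.perturb Δ)).PosDef := by
  refine .of_dotProduct_mulVec_pos (Wtilde_isHermitian _ isHermitian_one) fun w hw => ?_
  obtain ⟨x, y, u, rfl⟩ : ∃ x y u, w = Sum.elim x (Sum.elim y u) :=
    ⟨w ∘ Sum.inl, (w ∘ Sum.inr) ∘ Sum.inl, (w ∘ Sum.inr) ∘ Sum.inr, by simp⟩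
  have h1 := h.dotProduct_mulVec_nonneg (Sum.elim x (Sum.elim y u))
  rw [sub_mulVec, dotProduct_sub, smul_mulVec, dotProduct_smul, weight_form, one_mulVec,
    one_mulVec, star_dotProduct_self_eq, star_dotProduct_self_eq, star_dotProduct_self_eq] at h1
  have hsum : ∀ {a b : ℕ} (p : Fin a → ℂ) (q : Fin b → ℂ), ‖WithLp.toLp 2 (Sum.elim p q)‖ ^ 2 =
      ‖WithLp.toLp 2 p‖ ^ 2 + ‖WithLp.toLp 2 q‖ ^ 2 := by
    intro a b p q
    simp [EuclideanSpace.norm_sq_eq]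
  have h2 := norm_form_le_size ν Δ (Sum.elim x u) (Sum.elim y u)
  have h3 : star (Δ *ᵥ Sum.elim y u) ⬝ᵥ Sum.elim x u =
      star (star (Sum.elim x u) ⬝ᵥ Δ *ᵥ Sum.elim y u) := by
    rw [star_dotProduct]
  rw [Wtilde_perturb_form, h3]
  set s := star (Sum.elim x u) ⬝ᵥ Δ *ᵥ Sum.elim y u
  set t := star (Sum.elim x (Sum.elim y u)) ⬝ᵥ Wtilde 1 M *ᵥ Sum.elim x (Sum.elim y u)
  have hpos : 0 < ‖WithLp.toLp 2 x‖ ^ 2 + ‖WithLp.toLp 2 y‖ ^ 2 + 2 * ‖WithLp.toLp 2 u‖ ^ 2 := by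
    by_contra hle
    have h1 := sq_nonneg (‖WithLp.toLp 2 x‖)
    have h2 := sq_nonneg (‖WithLp.toLp 2 y‖)
    have h3 := sq_nonneg (‖WithLp.toLp 2 u‖)
    have hx : ‖WithLp.toLp 2 x‖ ^ 2 = 0 := by linarith
    have hy : ‖WithLp.toLp 2 y‖ ^ 2 = 0 := by linarith
    have hu : ‖WithLp.toLp 2 u‖ ^ 2 = 0 := by linarith
    simp only [ne_eq, OfNat.ofNat_ne_zero, not_false_eq_true, pow_eq_zero_iff, norm_eq_zero,
      WithLp.toLp_eq_zero] at hx hy hu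
    apply hw
    rw [hx, hy, hu]
    ext (i | i | i) <;> rfl
  rw [Complex.nonneg_iff] at h1
  rw [Complex.pos_iff]
  obtain ⟨h1re, h1im⟩ := h1
  norm_cast at h1re h1im
  simp only [Complex.sub_re, Complex.sub_im, Complex.real_smul, Complex.re_ofReal_mul,
    Complex.im_ofReal_mul, Complex.ofReal_re, Complex.ofReal_im, mul_zero, sub_zero] at h1re h1im
  refine ⟨?_, by simp; linarith⟩
  have hs : -‖s‖ ≤ s.re := (abs_le.1 (Complex.abs_re_le_norm s)).1
  have e1 := hsum x u
  have e2 := hsum y u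
  have hν := ν.size_nonneg Δ
  have : (t + (s + star s)).re = t.re + 2 * s.re := by simp; ring
  rw [this]
  -- By AM–GM, 2‖(x,u)‖‖(y,u)‖ ≤ ‖(x,u)‖² + ‖(y,u)‖². Here u is counted twice, which matches the
  -- weight diag(I, I, 2I) exactly.
  have h4 := sq_nonneg (‖WithLp.toLp 2 (Sum.elim x u)‖ - ‖WithLp.toLp 2 (Sum.elim y u)‖)
  have h5 : 2 * (‖WithLp.toLp 2 (Sum.elim x u)‖ * ‖WithLp.toLp 2 (Sum.elim y u)‖) ≤
    ‖WithLp.toLp 2 x‖ ^ 2 + ‖WithLp.toLp 2 y‖ ^ 2 + 2 * ‖WithLp.toLp 2 u‖ ^ 2 := by nlinarith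
  have h6 := mul_le_mul_of_nonneg_left h5 hν
  have h7 := mul_lt_mul_of_pos_right hΔ hpos
  linarith

lemma isUnit_resolvent {A : Matrix (Fin n) (Fin n) ℂ} {z : ℂ} (hz : z ∉ spectrum ℂ A) :
    IsUnit (z • (1 : Matrix (Fin n) (Fin n) ℂ) - A).det := by
  rw [spectrum.notMem_iff, Algebra.algebraMap_eq_smul_one] at hz
  exact (isUnit_iff_isUnit_det _).1 hz

lemma transfer_mulVec {M : StateSpace n m} {z : ℂ} (hz : z ∉ spectrum ℂ M.A) {x : Fin n → ℂ}
    {u : Fin m → ℂ} (h : M.A *ᵥ x + M.B *ᵥ u = z • x) :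
    M.C *ᵥ x + M.D *ᵥ u = M.transfer z *ᵥ u := by
  have e : M.B *ᵥ u = (z • (1 : Matrix (Fin n) (Fin n) ℂ) - M.A) *ᵥ x := by
    rw [sub_mulVec, smul_mulVec, one_mulVec, ← h]
    simp
  have : (z • (1 : Matrix (Fin n) (Fin n) ℂ) - M.A)⁻¹ *ᵥ M.B *ᵥ u = x := by
    rw [e, mulVec_mulVec, nonsing_inv_mul _ (isUnit_resolvent hz), one_mulVec]
  rw [transfer, add_mulVec, ← mulVec_mulVec, ← mulVec_mulVec, this]

/-- The frequency-domain form at a state-input pair with `A x + B u = z x`, `|z| = 1`. -/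
lemma W_form_frequency (M : StateSpace n m) (X : Matrix (Fin n) (Fin n) ℂ) {z : ℂ} (hz1 : ‖z‖ = 1)
    (hz : z ∉ spectrum ℂ M.A) {x : Fin n → ℂ} {u : Fin m → ℂ}
    (h : M.A *ᵥ x + M.B *ᵥ u = z • x) :
    star (Sum.elim x u) ⬝ᵥ W X M *ᵥ Sum.elim x u =
      star u ⬝ᵥ ((M.transfer z)ᴴ + M.transfer z) *ᵥ u := by
  -- Since |z| = 1, the two terms in X cancel and only the transfer function remains.
  have hzz : star z * z = 1 := by
    rw [Complex.star_def, ← Complex.normSq_eq_conj_mul_self, Complex.normSq_eq_norm_sq, hz1]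
    simp
  rw [W_form, h, transfer_mulVec hz h, add_mulVec, dotProduct_add,
    dotProduct_conjTranspose_mulVec, mulVec_smul, star_smul, smul_dotProduct, dotProduct_smul,
    smul_smul, hzz, one_smul]
  ring

/-- The easy half of KYP. An eigenvector v of A gives (1 - |z|²) vᴴXv > 0 at (v, 0). On the unit
circle, x = (zI - A)⁻¹Bu turns the form of `W` into that of T(z)ᴴ + T(z). -/
lemma isStrictlyPassive_of_W {M : StateSpace n m} {X : Matrix (Fin n) (Fin n) ℂ}
    (hX : X.PosDef) (hW : (W X M).PosDef) : M.IsStrictlyPassive := by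
  have hstab : M.IsAsymptoticallyStable := by
    intro z hz
    rw [← spectrum_toLin', ← Module.End.hasEigenvalue_iff_mem_spectrum] at hz
    obtain ⟨v, hv⟩ := hz.exists_hasEigenvector
    have hv1 : M.A *ᵥ v = z • v := by simpa using hv.apply_eq_smul
    have h := hW.dotProduct_mulVec_pos (x := Sum.elim v 0) (fun h0 => hv.2 (by
      ext i
      exact congrFun h0 (Sum.inl i)))
    rw [W_form] at h
    simp only [mulVec_zero, add_zero, star_zero, zero_dotProduct, dotProduct_zero, hv1,
      mulVec_smul, star_smul, smul_dotProduct, dotProduct_smul, smul_smul] at h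
    have hp := hX.dotProduct_mulVec_pos hv.2
    set p := star v ⬝ᵥ X *ᵥ v
    rw [Complex.pos_iff] at h hp
    have hzz : star z * z = ((‖z‖ ^ 2 : ℝ) : ℂ) := by
      rw [Complex.star_def, ← Complex.normSq_eq_conj_mul_self, Complex.normSq_eq_norm_sq]
    rw [mul_comm z, hzz] at h
    have h1 := h.1
    simp only [smul_eq_mul, Complex.sub_re, Complex.re_ofReal_mul] at h1
    have h2 : ‖z‖ ^ 2 < 1 := by nlinarith [hp.1]
    nlinarith [norm_nonneg z]
  refine ⟨fun ω _ => ?_, hstab⟩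
  set z := Complex.exp (ω * Complex.I)
  have hz1 : ‖z‖ = 1 := Complex.norm_exp_ofReal_mul_I ω
  have hz : z ∉ spectrum ℂ M.A := fun h => (hstab z h).ne hz1
  refine .of_dotProduct_mulVec_pos ?_ fun u hu => ?_
  · rw [IsHermitian, conjTranspose_add, conjTranspose_conjTranspose, add_comm]
  · set x := (z • (1 : Matrix (Fin n) (Fin n) ℂ) - M.A)⁻¹ *ᵥ M.B *ᵥ u with hx
    have h : M.A *ᵥ x + M.B *ᵥ u = z • x := by
      have : (z • (1 : Matrix (Fin n) (Fin n) ℂ) - M.A) *ᵥ x = M.B *ᵥ u := by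
        rw [hx, mulVec_mulVec, mul_nonsing_inv _ (isUnit_resolvent hz), one_mulVec]
      rw [← this, sub_mulVec, smul_mulVec, one_mulVec]
      simp
    rw [← W_form_frequency M X hz1 hz h]
    refine hW.dotProduct_mulVec_pos fun h0 => hu ?_
    ext i
    exact congrFun h0 (Sum.inr i)

end Passivity

/-! ### Unitary diagonalization and rank-one splitting of a dual certificate -/

section Diagonalization

open Module Module.End in
/-- A linear isometry of a finite-dimensional complex inner product space has an orthonormal basis
of eigenvectors. -/
lemma exists_orthonormalBasis_eigenvector {E : Type*} [NormedAddCommGroup E]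
    [InnerProductSpace ℂ E] [FiniteDimensional ℂ E] (U : E →ₗᵢ[ℂ] E) :
    ∃ (b : OrthonormalBasis (Fin (finrank ℂ E)) ℂ E) (μ : Fin (finrank ℂ E) → ℂ),
      ∀ i, U (b i) = μ i • b i := by
  classical
  set F : E →ₗ[ℂ] E := U.toLinearMap
  have h1 : LinearMap.adjoint F * F = 1 := by
    ext x
    refine ext_inner_left ℂ fun y => ?_
    rw [Module.End.mul_apply, LinearMap.adjoint_inner_right]
    exact U.inner_map_map y x
  have h2 : F * LinearMap.adjoint F = 1 := mul_eq_one_comm.1 h1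
  -- The isometry is unitary in finite dimension, so U + U* and i(U - U*) are commuting symmetric
  -- maps. On a joint eigenspace U acts as a scalar, because 2U = (U + U*) - i · i(U - U*).
  have hS : (F + LinearMap.adjoint F).IsSymmetric := by
    rw [LinearMap.isSymmetric_iff_isSelfAdjoint, LinearMap.isSelfAdjoint_iff', map_add,
      LinearMap.adjoint_adjoint, add_comm]
  have hK : (Complex.I • (F - LinearMap.adjoint F)).IsSymmetric := by
    rw [LinearMap.isSymmetric_iff_isSelfAdjoint, LinearMap.isSelfAdjoint_iff',
      LinearEquiv.map_smulₛₗ, map_sub, LinearMap.adjoint_adjoint]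
    simp only [Complex.conj_I, neg_smul, smul_sub]
    abel
  have hc : Commute (F + LinearMap.adjoint F) (Complex.I • (F - LinearMap.adjoint F)) := by
    refine Commute.smul_right ?_ _
    have : Commute F (LinearMap.adjoint F) := h2.trans h1.symm
    exact ((Commute.refl F).sub_right this).add_left (this.symm.sub_right (Commute.refl _))
  have hint := LinearMap.IsSymmetric.directSum_isInternal_of_commute hS hK hc
  -- Dropping the zero joint eigenspaces leaves a finite index type.
  have hint' := DirectSum.isInternal_ne_bot_iff.2 hint
  have horth := (LinearMap.IsSymmetric.orthogonalFamily_eigenspace_inf_eigenspace hS hK).comp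
    (Subtype.val_injective (p := fun i : ℂ × ℂ => eigenspace (F + LinearMap.adjoint F) i.2 ⊓
      eigenspace (Complex.I • (F - LinearMap.adjoint F)) i.1 ≠ ⊥))
  have : Finite {i : ℂ × ℂ // eigenspace (F + LinearMap.adjoint F) i.2 ⊓
      eigenspace (Complex.I • (F - LinearMap.adjoint F)) i.1 ≠ ⊥} :=
    WellFoundedGT.finite_ne_bot_of_iSupIndep hint.submodule_iSupIndep
  have := Fintype.ofFinite {i : ℂ × ℂ // eigenspace (F + LinearMap.adjoint F) i.2 ⊓
      eigenspace (Complex.I • (F - LinearMap.adjoint F)) i.1 ≠ ⊥}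
  refine ⟨hint'.subordinateOrthonormalBasis rfl horth, fun i =>
    ((hint'.subordinateOrthonormalBasisIndex rfl i horth).1.2 -
      Complex.I * (hint'.subordinateOrthonormalBasisIndex rfl i horth).1.1) / 2, fun i => ?_⟩
  have hmem := hint'.subordinateOrthonormalBasis_subordinate rfl i horth
  set v := hint'.subordinateOrthonormalBasis rfl horth i
  set α := hint'.subordinateOrthonormalBasisIndex rfl i horth
  obtain ⟨ha, hb⟩ := Submodule.mem_inf.1 hmem
  rw [mem_eigenspace_iff] at ha hb
  have hsum : U v = (2⁻¹ : ℂ) • ((F + LinearMap.adjoint F) v -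
      Complex.I • (Complex.I • (F - LinearMap.adjoint F)) v) := by
    simp only [LinearMap.add_apply, LinearMap.smul_apply, LinearMap.sub_apply, smul_smul,
      Complex.I_mul_I]
    have : F v = U v := rfl
    rw [this]
    module
  rw [hsum, ha, hb]
  module

/-- If `P Z Pᴴ = Q Z Qᴴ` with `Z ≥ 0`, then `Z` is a sum of rank-one terms `v vᴴ` with
`Q v = z P v` and `|z| = 1`. -/
lemma exists_rankOne_decomposition {k : ℕ} {ι : Type*} [Fintype ι] [DecidableEq ι]
    {Z : Matrix ι ι ℂ} (hZ : Z.PosSemidef) (P Q : Matrix (Fin k) ι ℂ)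
    (h : P * Z * Pᴴ = Q * Z * Qᴴ) :
    ∃ (N : ℕ) (v : Fin N → ι → ℂ) (z : Fin N → ℂ), (∀ i, ‖z i‖ = 1) ∧
      (∀ i, Q *ᵥ v i = z i • (P *ᵥ v i)) ∧
      ∀ H : Matrix ι ι ℂ, (Z * H).trace = ∑ i, star (v i) ⬝ᵥ H *ᵥ v i := by
  obtain ⟨G, rfl⟩ : ∃ G : Matrix ι ι ℂ, Z = Gᴴ * G := by
    open scoped MatrixOrder in
    exact CStarAlgebra.nonneg_iff_eq_star_mul_self.1 hZ.nonneg
  let p : EuclideanSpace ℂ (Fin k) →ₗ[ℂ] EuclideanSpace ℂ ι := toEuclideanLin (G * Pᴴ)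
  let q : EuclideanSpace ℂ (Fin k) →ₗ[ℂ] EuclideanSpace ℂ ι := toEuclideanLin (G * Qᴴ)
  -- With Z = GᴴG the hypothesis says that GPᴴ and GQᴴ have the same Gram matrix. Hence GPᴴw ↦ GQᴴw
  -- is a well-defined isometry on the range of p, and it extends to the whole space.
  have hnorm : ∀ w, ‖p w‖ = ‖q w‖ := by
    have key : ∀ (R : Matrix (Fin k) ι ℂ) (w : EuclideanSpace ℂ (Fin k)),
        ((‖toEuclideanLin (G * Rᴴ) w‖ ^ 2 : ℝ) : ℂ) =
          star w.ofLp ⬝ᵥ (R * (Gᴴ * G) * Rᴴ) *ᵥ w.ofLp := by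
      intro R w
      have := star_dotProduct_self_eq ((G * Rᴴ) *ᵥ w.ofLp)
      rw [← dotProduct_conjTranspose_mulVec, mulVec_mulVec, conjTranspose_mul,
        conjTranspose_conjTranspose] at this
      simp only [Matrix.mul_assoc] at this ⊢
      exact this.symm
    intro w
    have h2 : ‖p w‖ ^ 2 = ‖q w‖ ^ 2 := by
      have := (key P w).trans ((congrArg (fun R => star w.ofLp ⬝ᵥ R *ᵥ w.ofLp) h).trans
        (key Q w).symm)
      exact_mod_cast this
    exact (sq_eq_sq₀ (norm_nonneg _) (norm_nonneg _)).1 h2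
  obtain ⟨s, hs⟩ := p.rangeRestrict.exists_rightInverse_of_surjective p.range_rangeRestrict
  have hs' : ∀ r, p (s r) = r := fun r => congrArg Subtype.val (LinearMap.congr_fun hs r)
  let L : LinearMap.range p →ₗᵢ[ℂ] EuclideanSpace ℂ ι :=
    { toLinearMap := q ∘ₗ s
      norm_map' := fun r => by
        rw [LinearMap.comp_apply, ← hnorm, hs']
        rfl }
  have hL : ∀ w, L.extend (p w) = q w := by
    intro w
    have : L.extend (p w) = L ⟨p w, LinearMap.mem_range_self p w⟩ :=
      LinearIsometry.extend_apply L ⟨p w, LinearMap.mem_range_self p w⟩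
    rw [this]
    change q (s ⟨p w, LinearMap.mem_range_self p w⟩) = q w
    rw [← sub_eq_zero, ← map_sub, ← norm_eq_zero, ← hnorm, map_sub, hs', sub_self, norm_zero]
  obtain ⟨b, μ, hb⟩ := exists_orthonormalBasis_eigenvector L.extend
  have hμ : ∀ i, ‖μ i‖ = 1 := by
    intro i
    have := congrArg norm (hb i)
    rw [LinearIsometry.norm_map, norm_smul, b.norm_eq_one, mul_one] at this
    exact this.symm
  -- From GQᴴ = U GPᴴ and U bᵢ = μᵢ bᵢ, taking inner products with bᵢ gives Q Gᴴbᵢ = μ̄ᵢ P Gᴴbᵢ,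
  -- hence the conjugate.
  refine ⟨_, fun i => Gᴴ *ᵥ (b i).ofLp, fun i => star (μ i), fun i => by simp [hμ i],
    fun i => ?_, fun H => ?_⟩
  · have hdual : ∀ (R : Matrix (Fin k) ι ℂ) (w : EuclideanSpace ℂ (Fin k)),
        inner ℂ (toEuclideanLin (G * Rᴴ) w) (b i) =
          star w.ofLp ⬝ᵥ R *ᵥ Gᴴ *ᵥ (b i).ofLp := by
      intro R w
      rw [EuclideanSpace.inner_eq_star_dotProduct, dotProduct_comm]
      have : (toEuclideanLin (G * Rᴴ) w).ofLp = (G * Rᴴ) *ᵥ w.ofLp := rfl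
      rw [this, ← dotProduct_conjTranspose_mulVec, conjTranspose_mul, conjTranspose_conjTranspose,
        mulVec_mulVec]
    have hμμ : star (μ i) * μ i = 1 := by
      rw [Complex.star_def, ← Complex.normSq_eq_conj_mul_self, Complex.normSq_eq_norm_sq, hμ]
      simp
    have hinner : ∀ w, inner ℂ (q w) (b i) = star (μ i) * inner ℂ (p w) (b i) := by
      intro w
      have e : b i = star (μ i) • L.extend (b i) := by
        rw [hb, smul_smul, hμμ, one_smul]
      conv_lhs => rw [e, ← hL, inner_smul_right, LinearIsometry.inner_map_map]
    have hall : ∀ w : Fin k → ℂ, star w ⬝ᵥ (Q *ᵥ Gᴴ *ᵥ (b i).ofLp) =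
        star w ⬝ᵥ (star (μ i) • (P *ᵥ Gᴴ *ᵥ (b i).ofLp)) := by
      intro w
      have := hinner (WithLp.toLp 2 w)
      rw [dotProduct_smul, smul_eq_mul, ← hdual Q (WithLp.toLp 2 w), ← hdual P (WithLp.toLp 2 w)]
      exact this
    exact dotProduct_eq _ _ fun w => by
      have := hall (star w)
      rw [star_star] at this
      rw [dotProduct_comm, this, dotProduct_comm]
  -- tr(ZH) = tr(GHGᴴ), evaluated in the orthonormal basis b.
  · have e : (Gᴴ * G * H).trace = (G * H * Gᴴ).trace := by
      rw [Matrix.mul_assoc, trace_mul_comm]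
    have e2 := LinearMap.trace_eq_sum_inner (toEuclideanLin (G * H * Gᴴ)) b
    rw [toEuclideanLin_eq_toLin_orthonormal, trace_toLin_eq] at e2
    rw [e, e2]
    refine Finset.sum_congr rfl fun i _ => ?_
    rw [← toEuclideanLin_eq_toLin_orthonormal, EuclideanSpace.inner_eq_star_dotProduct,
      dotProduct_comm, ← dotProduct_conjTranspose_mulVec, conjTranspose_conjTranspose,
      mulVec_mulVec, mulVec_mulVec]
    rfl

end Diagonalization

end StateSpace

namespace StateSpace

open Matrix Filter Topology

/-! ### The strict Kalman–Yakubovich–Popov lemma by duality -/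

section KYP

variable {n m : ℕ}

/-- The powers of an asymptotically stable matrix tend to zero. -/
lemma tendsto_pow_mulVec {A : Matrix (Fin n) (Fin n) ℂ} (hA : ∀ z ∈ spectrum ℂ A, ‖z‖ < 1)
    (v : Fin n → ℂ) : Tendsto (fun k : ℕ => A ^ k *ᵥ v) atTop (𝓝 0) := by
  rcases subsingleton_or_nontrivial (Matrix (Fin n) (Fin n) ℂ) with hs | hn
  · have : ∀ k : ℕ, A ^ k *ᵥ v = 0 := fun k => by
      rw [Subsingleton.elim (A ^ k) 0, zero_mulVec]
    simp [this]
  let _ := Matrix.linftyOpNormedRing (n := Fin n) (α := ℂ)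
  let _ := Matrix.linftyOpNormedAlgebra (n := Fin n) (R := ℂ) (α := ℂ)
  have hr : spectralRadius ℂ A < ((1 : NNReal) : ℝ≥0∞) :=
    spectrum.spectralRadius_lt_of_forall_lt A fun z hz => by exact_mod_cast hA z hz
  obtain ⟨r, hr1, hr2⟩ := ENNReal.lt_iff_exists_nnreal_btwn.1 hr
  -- Gelfand's formula: ‖Aᵏ‖^(1/k) is eventually below some r < 1.
  have hev := (spectrum.pow_nnnorm_pow_one_div_tendsto_nhds_spectralRadius A).eventually_lt_const hr1
  have hr2' : (r : ℝ) < 1 := by exact_mod_cast hr2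
  have hpow : Tendsto (fun k : ℕ => A ^ k) atTop (𝓝 0) := by
    refine squeeze_zero_norm' ?_ (tendsto_pow_atTop_nhds_zero_of_lt_one r.2 hr2')
    filter_upwards [hev, eventually_gt_atTop 0] with k hk hk0
    have hk' : (k : ℝ) ≠ 0 := by positivity
    have := ENNReal.rpow_le_rpow hk.le (Nat.cast_nonneg k : (0 : ℝ) ≤ k)
    rw [← ENNReal.rpow_mul, one_div_mul_cancel hk', ENNReal.rpow_one, ENNReal.rpow_natCast] at this
    exact_mod_cast this
  have hc : Continuous fun Y : Matrix (Fin n) (Fin n) ℂ => Y *ᵥ v :=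
    continuous_id.matrix_mulVec continuous_const
  simpa [Function.comp_def] using (hc.tendsto 0).comp hpow

/-- Lyapunov: for stable `A`, a Hermitian `X` with `W(X, M) ≥ 0` is positive semidefinite. -/
lemma posSemidef_of_W {M : StateSpace n m} (hM : M.IsAsymptoticallyStable)
    {X : Matrix (Fin n) (Fin n) ℂ} (hX : X.IsHermitian) (hW : (W X M).PosSemidef) :
    X.PosSemidef := by
  refine .of_dotProduct_mulVec_nonneg hX fun v => ?_
  -- The form of X does not increase along v, Av, A²v, … and tends to 0 there, so its initial value
  -- is nonnegative.
  have hstep : ∀ y : Fin n → ℂ, star (M.A *ᵥ y) ⬝ᵥ X *ᵥ (M.A *ᵥ y) ≤ star y ⬝ᵥ X *ᵥ y := by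
    intro y
    have h := hW.dotProduct_mulVec_nonneg (Sum.elim y 0)
    rw [W_form] at h
    simp only [mulVec_zero, add_zero, star_zero, zero_dotProduct, dotProduct_zero] at h
    exact sub_nonneg.1 h
  have hk : ∀ k : ℕ, star (M.A ^ k *ᵥ v) ⬝ᵥ X *ᵥ (M.A ^ k *ᵥ v) ≤ star v ⬝ᵥ X *ᵥ v := by
    intro k
    induction k with
    | zero => simp
    | succ k ih =>
      refine le_trans ?_ ih
      rw [pow_succ', ← mulVec_mulVec]
      exact hstep _
  have hc : Continuous fun y : Fin n → ℂ => star y ⬝ᵥ X *ᵥ y :=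
    continuous_star.dotProduct (continuous_const.matrix_mulVec continuous_id)
  have hlim := (hc.tendsto 0).comp (tendsto_pow_mulVec hM v)
  simp only [star_zero, zero_dotProduct] at hlim
  exact le_of_tendsto hlim (Eventually.of_forall hk)

/-- The projection `[I, 0]` of a state-input pair to the state. -/
def stateProj (n m : ℕ) : Matrix (Fin n) (Fin n ⊕ Fin m) ℂ := fromCols 1 0

lemma fromCols_congr (X P : Matrix (Fin n) (Fin n) ℂ) (Q : Matrix (Fin n) (Fin m) ℂ) :
    (fromCols P Q)ᴴ * X * fromCols P Q =
      fromBlocks (Pᴴ * X * P) (Pᴴ * X * Q) (Qᴴ * X * P) (Qᴴ * X * Q) := by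
  rw [conjTranspose_fromCols_eq_fromRows_conjTranspose, fromRows_mul, fromRows_mul_fromCols]

/-- Displays `W` as affine in X. For the trace pairing, the adjoint of its linear part is Z ↦ PZPᴴ -
QZQᴴ with P = [I, 0] and Q = [A, B]. -/
lemma W_eq_add (M : StateSpace n m) (X : Matrix (Fin n) (Fin n) ℂ) :
    W X M = W 0 M + ((stateProj n m)ᴴ * X * stateProj n m -
      (fromCols M.A M.B)ᴴ * X * fromCols M.A M.B) := by
  rw [W, W, stateProj, fromCols_congr, fromCols_congr, fromBlocks_sub_fromBlocks, fromBlocks_add]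
  congr 1 <;> simp [sub_eq_add_neg]

/-- Matrices whose quadratic form has positive real part form an open set. -/
lemma isOpen_form_re_pos (ι : Type*) [Fintype ι] :
    IsOpen {Y : Matrix ι ι ℂ | ∀ v ∈ Metric.sphere (0 : ι → ℂ) 1, 0 < (star v ⬝ᵥ Y *ᵥ v).re} := by
  rw [isOpen_iff_eventually]
  intro Y hY
  refine (isCompact_sphere (0 : ι → ℂ) 1).eventually_forall_of_forall_eventually fun v hv => ?_
  have hc : Continuous fun p : Matrix ι ι ℂ × (ι → ℂ) => (star p.2 ⬝ᵥ p.1 *ᵥ p.2).re :=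
    Complex.continuous_re.comp (continuous_snd.star.dotProduct
      (continuous_fst.matrix_mulVec continuous_snd))
  exact hc.continuousAt.eventually (lt_mem_nhds (hY v hv))

lemma form_re_pos_of_sphere {ι : Type*} [Fintype ι] {Y : Matrix ι ι ℂ}
    (hY : ∀ v ∈ Metric.sphere (0 : ι → ℂ) 1, 0 < (star v ⬝ᵥ Y *ᵥ v).re) {v : ι → ℂ} (hv : v ≠ 0) :
    0 < (star v ⬝ᵥ Y *ᵥ v).re := by
  have hn : 0 < ‖v‖ := norm_pos_iff.2 hv
  have h := hY ((‖v‖⁻¹ : ℝ) • v) (by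
    rw [mem_sphere_zero_iff_norm, norm_smul, norm_inv, norm_norm, inv_mul_cancel₀ hn.ne'])
  rw [star_smul, mulVec_smul, smul_dotProduct, dotProduct_smul, Complex.smul_re, Complex.smul_re,
    smul_eq_mul, smul_eq_mul] at h
  simp only [star_trivial] at h
  have h2 : (0 : ℝ) < ‖v‖⁻¹ := inv_pos.2 hn
  exact (mul_pos_iff_of_pos_left h2).1 ((mul_pos_iff_of_pos_left h2).1 h)

/-- Theorem of the alternative: if no Hermitian `X` solves the strict linear matrix inequality,
there is a dual certificate. -/
lemma exists_dual_certificate (M : StateSpace n m)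
    (h : ∀ X : Matrix (Fin n) (Fin n) ℂ, X.IsHermitian → ¬ (W X M).PosDef) :
    ∃ Z : Matrix (Fin n ⊕ Fin m) (Fin n ⊕ Fin m) ℂ, Z.PosSemidef ∧ Z ≠ 0 ∧
      (Z * W 0 M).trace.re ≤ 0 ∧
      stateProj n m * Z * (stateProj n m)ᴴ =
        fromCols M.A M.B * Z * (fromCols M.A M.B)ᴴ := by
  set P := stateProj n m
  set Q := fromCols M.A M.B
  -- Only the real part of the form is constrained: the positive definite Hermitian matrices are not
  -- open among all complex matrices.
  set s := {Y : Matrix (Fin n ⊕ Fin m) (Fin n ⊕ Fin m) ℂ |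
    ∀ v ∈ Metric.sphere (0 : Fin n ⊕ Fin m → ℂ) 1, 0 < (star v ⬝ᵥ Y *ᵥ v).re}
  set t := {Y : Matrix (Fin n ⊕ Fin m) (Fin n ⊕ Fin m) ℂ |
    ∃ X : Matrix (Fin n) (Fin n) ℂ, X.IsHermitian ∧ Y = W X M}
  have hsconv : Convex ℝ s := by
    refine convex_iff_forall_pos.2 fun Y hY Y' hY' a b ha hb _ v hv => ?_
    rw [add_mulVec, dotProduct_add, smul_mulVec, smul_mulVec, dotProduct_smul, dotProduct_smul,
      Complex.add_re, Complex.smul_re, Complex.smul_re]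
    exact add_pos (mul_pos ha (hY v hv)) (mul_pos hb (hY' v hv))
  have htconv : Convex ℝ t := by
    rintro Y ⟨X, hX, rfl⟩ Y' ⟨X', hX', rfl⟩ a b ha hb hab
    refine ⟨a • X + b • X', ?_, ?_⟩
    · rw [IsHermitian, conjTranspose_add, conjTranspose_smul, conjTranspose_smul, hX.eq, hX'.eq]
      simp
    · rw [W_eq_add M X, W_eq_add M X', W_eq_add M (a • X + b • X')]
      have : W 0 M = a • W 0 M + b • W 0 M := by rw [← add_smul, hab, one_smul]
      conv_rhs => rw [this]
      simp only [Matrix.mul_add, Matrix.add_mul, Matrix.mul_smul, Matrix.smul_mul, smul_add,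
        smul_sub]
      abel
  have hdisj : Disjoint s t := by
    rw [Set.disjoint_left]
    rintro Y hY ⟨X, hX, rfl⟩
    have hH := W_isHermitian M hX
    refine h X hX (.of_dotProduct_mulVec_pos hH fun v hv => ?_)
    rw [Complex.pos_iff]
    exact ⟨form_re_pos_of_sphere hY hv, (hH.im_star_dotProduct_mulVec_self v).symm⟩
  obtain ⟨f, c, hfs, hft⟩ := RCLike.geometric_hahn_banach_open (𝕜 := ℂ) hsconv
    (isOpen_form_re_pos _) htconv hdisj
  simp only [RCLike.re_to_complex] at hfs hft
  have hcone : ∀ Y ∈ s, ∀ r : ℝ, 0 < r → r • Y ∈ s := by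
    intro Y hY r hr v hv
    rw [smul_mulVec, dotProduct_smul, Complex.smul_re]
    exact mul_pos hr (hY v hv)
  have hfr : ∀ (r : ℝ) Y, (f (r • Y)).re = r * (f Y).re := by
    intro r Y
    rw [← Complex.coe_smul, map_smul, smul_eq_mul, Complex.re_ofReal_mul]
  have hone : (1 : Matrix (Fin n ⊕ Fin m) (Fin n ⊕ Fin m) ℂ) ∈ s := by
    intro v hv
    have hv0 : v ≠ 0 := by
      rintro rfl
      simp at hv
    exact (Complex.pos_iff.1 (PosDef.one.dotProduct_mulVec_pos hv0)).1
  have hc : 0 ≤ c := by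
    by_contra! hc
    have h1 := hfs 1 hone
    have h2 := hfs _ (hcone 1 hone (c / (f 1).re) (div_pos_of_neg_of_neg hc (h1.trans hc)))
    rw [hfr, div_mul_cancel₀ _ (h1.trans hc).ne] at h2
    exact h2.false
  have hneg : ∀ Y ∈ s, (f Y).re ≤ 0 := by
    intro Y hY
    by_contra! hpos
    have h1 := hfs _ (hcone Y hY ((c + 1) / (f Y).re) (by positivity))
    rw [hfr, div_mul_cancel₀ _ hpos.ne'] at h1
    linarith
  have hrank : ∀ v, (f (vecMulVec v (star v))).re ≤ 0 := by
    intro v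
    by_contra! hpos
    have h1 := hneg 1 hone
    -- With this ε, the functional takes the value ε > 0 at vvᴴ + εI, although that matrix lies in
    -- the open cone.
    have hε : 0 < (f (vecMulVec v (star v))).re / (1 - (f 1).re) := div_pos hpos (by linarith)
    have h2 := hneg (vecMulVec v (star v) + ((f (vecMulVec v (star v))).re / (1 - (f 1).re)) • 1) (by
      intro w hw
      have hw0 : w ≠ 0 := by
        rintro rfl
        simp at hw
      exact (Complex.pos_iff.1 (((PosDef.one.smul hε).posSemidef_add
        (posSemidef_vecMulVec_self_star v)).dotProduct_mulVec_pos hw0)).1)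
    rw [map_add, Complex.add_re, hfr] at h2
    have h3 : (f (vecMulVec v (star v))).re + (f (vecMulVec v (star v))).re / (1 - (f 1).re) *
        (f 1).re = (f (vecMulVec v (star v))).re / (1 - (f 1).re) := by
      have : 1 - (f 1).re ≠ 0 := by linarith
      field_simp
      ring
    linarith
  -- G represents f by the trace pairing. The certificate is -(G + Gᴴ), with which a Hermitian H
  -- pairs to -2 Re f(H).
  set G : Matrix (Fin n ⊕ Fin m) (Fin n ⊕ Fin m) ℂ := of fun i j => f (single j i 1) with hG
  have hfG : ∀ Y, f Y = (G * Y).trace := by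
    intro Y
    conv_lhs => rw [matrix_eq_sum_single Y]
    simp only [map_sum, trace, diag_apply, mul_apply, hG, of_apply]
    rw [Finset.sum_comm]
    refine Finset.sum_congr rfl fun j _ => Finset.sum_congr rfl fun i _ => ?_
    have : single i j (Y i j) = Y i j • single i j (1 : ℂ) := by
      rw [smul_single, smul_eq_mul, mul_one]
    rw [this, map_smul, smul_eq_mul, mul_comm]
  have htrace : ∀ H : Matrix (Fin n ⊕ Fin m) (Fin n ⊕ Fin m) ℂ, H.IsHermitian →
      (-(G + Gᴴ) * H).trace = ((-2 * (f H).re : ℝ) : ℂ) := by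
    intro H hH
    have h1 : (Gᴴ * H).trace = star (f H) := by
      rw [hfG, trace_mul_comm G, ← trace_conjTranspose, conjTranspose_mul, hH.eq]
    rw [neg_mul, trace_neg, Matrix.add_mul, trace_add, h1, ← hfG, Complex.star_def,
      Complex.add_conj]
    push_cast
    ring
  have hZH : (-(G + Gᴴ)).IsHermitian := by
    rw [IsHermitian, conjTranspose_neg, conjTranspose_add, conjTranspose_conjTranspose, add_comm]
  have hW0 : (f (W 0 M)).re ≥ 0 := hc.trans (hft _ ⟨0, isHermitian_zero, rfl⟩)
  refine ⟨-(G + Gᴴ), .of_dotProduct_mulVec_nonneg hZH fun v => ?_, fun h0 => ?_, ?_, ?_⟩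
  · have hv : (vecMulVec v (star v)).IsHermitian := (posSemidef_vecMulVec_self_star v).1
    have e := htrace _ hv
    rw [mul_vecMulVec, trace_vecMulVec, dotProduct_comm] at e
    rw [e, Complex.zero_le_real]
    linarith [hrank v]
  · have e := htrace 1 isHermitian_one
    rw [h0, Matrix.zero_mul, trace_zero] at e
    have e2 := htrace _ (W_isHermitian M isHermitian_zero)
    rw [h0, Matrix.zero_mul, trace_zero] at e2
    have h1 := hfs 1 hone
    have h2 := hft _ ⟨0, isHermitian_zero, rfl⟩
    have e' : -2 * (f 1).re = 0 := by exact_mod_cast e.symm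
    have e2' : -2 * (f (W 0 M)).re = 0 := by exact_mod_cast e2.symm
    linarith
  · rw [htrace _ (W_isHermitian M isHermitian_zero), Complex.ofReal_re]
    linarith
  · set Z := -(G + Gᴴ)
    set K := P * Z * Pᴴ - Q * Z * Qᴴ with hK
    have hKH : K.IsHermitian := by
      simp [hK, IsHermitian, hZH.eq, Matrix.mul_assoc]
    -- An affine function of r bounded below has zero slope. Moving X in the direction K = PZPᴴ -
    -- QZQᴴ itself makes this slope a multiple of tr K², so K = 0.
    have hlin : ∀ r : ℝ, 0 ≤ (f (W 0 M)).re + r * (f (Pᴴ * K * P - Qᴴ * K * Q)).re := by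
      intro r
      have hr : (r • K).IsHermitian := by
        rw [IsHermitian, conjTranspose_smul, hKH.eq, star_trivial]
      have h1 := hc.trans (hft _ ⟨r • K, hr, rfl⟩)
      rw [W_eq_add] at h1
      have e : Pᴴ * (r • K) * P - Qᴴ * (r • K) * Q = r • (Pᴴ * K * P - Qᴴ * K * Q) := by
        simp only [Matrix.mul_smul, Matrix.smul_mul, smul_sub]
      rw [e, map_add, Complex.add_re, hfr] at h1
      exact h1
    have hzero : (f (Pᴴ * K * P - Qᴴ * K * Q)).re = 0 := by
      by_contra hne
      have h1 := hlin (-((f (W 0 M)).re + 1) / (f (Pᴴ * K * P - Qᴴ * K * Q)).re)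
      rw [div_mul_cancel₀ _ hne] at h1
      linarith
    have hKK : (Kᴴ * K).trace = 0 := by
      have h1 : (Pᴴ * K * P - Qᴴ * K * Q).IsHermitian := by
        simp [IsHermitian, hKH.eq, Matrix.mul_assoc]
      have e := htrace _ h1
      rw [hzero, mul_zero, Complex.ofReal_zero] at e
      have hcyc : ∀ R : Matrix (Fin n) (Fin n ⊕ Fin m) ℂ,
          (R * Z * Rᴴ * K).trace = (Z * (Rᴴ * K * R)).trace := by
        intro R
        rw [Matrix.mul_assoc R Z, Matrix.mul_assoc R, trace_mul_comm]
        simp only [Matrix.mul_assoc]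
      rw [Matrix.mul_sub, trace_sub, ← hcyc, ← hcyc, ← trace_sub, ← Matrix.sub_mul] at e
      rw [hKH.eq]
      exact e
    exact sub_eq_zero.1 (trace_conjTranspose_mul_self_eq_zero_iff.1 hKK)

/-- The strict Kalman–Yakubovich–Popov lemma. -/
lemma exists_W_posDef {M : StateSpace n m} (hM : M.IsStrictlyPassive) :
    ∃ X : Matrix (Fin n) (Fin n) ℂ, X.IsHermitian ∧ (W X M).PosDef := by
  by_contra hcon
  push Not at hcon
  obtain ⟨Z, hZ, hZ0, htr, heq⟩ := exists_dual_certificate M hcon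
  obtain ⟨N, v, z, hz, hv, htrace⟩ := exists_rankOne_decomposition hZ _ _ heq
  have hdyn : ∀ i, M.A *ᵥ (v i ∘ Sum.inl) + M.B *ᵥ (v i ∘ Sum.inr) = z i • (v i ∘ Sum.inl) := by
    intro i
    have := hv i
    rw [stateProj, fromCols_mulVec, fromCols_mulVec, zero_mulVec, one_mulVec, add_zero] at this
    exact this
  have hspec : ∀ i, z i ∉ spectrum ℂ M.A := fun i hi => (hM.2 _ hi).ne (hz i)
  have hΦ : ∀ i, ((M.transfer (z i))ᴴ + M.transfer (z i)).PosDef := by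
    intro i
    have e : Complex.exp (Complex.arg (z i) * Complex.I) = z i := by
      have := Complex.norm_mul_exp_arg_mul_I (z i)
      rwa [hz i, Complex.ofReal_one, one_mul] at this
    have := hM.1 (Complex.arg (z i)) ⟨(Complex.neg_pi_lt_arg _).le, Complex.arg_le_pi _⟩
    rwa [e] at this
  have hform : ∀ i, star (v i) ⬝ᵥ W 0 M *ᵥ v i = star (v i ∘ Sum.inr) ⬝ᵥ
      ((M.transfer (z i))ᴴ + M.transfer (z i)) *ᵥ (v i ∘ Sum.inr) := by
    intro i
    rw [← W_form_frequency M 0 (hz i) (hspec i) (hdyn i), Sum.elim_comp_inl_inr]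
  have hnonneg : ∀ i, 0 ≤ star (v i) ⬝ᵥ W 0 M *ᵥ v i := fun i => by
    rw [hform]
    exact (hΦ i).posSemidef.dotProduct_mulVec_nonneg _
  -- Each term is nonnegative by strict positive realness, while the certificate makes the sum
  -- nonpositive. So every input part vanishes, and then every state part, since zᵢ is not an
  -- eigenvalue of A.
  have hsum : ∑ i, star (v i) ⬝ᵥ W 0 M *ᵥ v i = 0 := by
    refine le_antisymm ?_ (Finset.sum_nonneg fun i _ => hnonneg i)
    have h0 := Finset.sum_nonneg fun i (_ : i ∈ Finset.univ) => hnonneg i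
    rw [← htrace] at h0 ⊢
    rw [Complex.nonneg_iff] at h0
    rw [Complex.nonpos_iff]
    exact ⟨htr, h0.2.symm⟩
  have hu : ∀ i, v i ∘ Sum.inr = 0 := by
    intro i
    have h0 := (Finset.sum_eq_zero_iff_of_nonneg fun i _ => hnonneg i).1 hsum i (Finset.mem_univ i)
    by_contra hne
    rw [hform] at h0
    exact ((hΦ i).dotProduct_mulVec_pos hne).ne' h0
  have hx : ∀ i, v i ∘ Sum.inl = 0 := by
    intro i
    have := hdyn i
    rw [hu i, mulVec_zero, add_zero] at this
    have h0 : (z i • (1 : Matrix (Fin n) (Fin n) ℂ) - M.A) *ᵥ (v i ∘ Sum.inl) = 0 := by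
      rw [sub_mulVec, smul_mulVec, one_mulVec, this, sub_self]
    exact eq_zero_of_mulVec_eq_zero (isUnit_resolvent (hspec i)).ne_zero h0
  have hv0 : ∀ i, v i = 0 := fun i => by
    rw [← Sum.elim_comp_inl_inr (v i), hx, hu]
    ext (j | j) <;> rfl
  refine hZ0 (hZ.trace_eq_zero_iff.1 ?_)
  have := htrace 1
  rw [Matrix.mul_one] at this
  rw [this]
  simp [hv0]

/-- The solution of the linear matrix inequality of a strictly passive model. -/
lemma exists_Wtilde_posSemidef {M : StateSpace n m} (hM : M.IsStrictlyPassive) :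
    ∃ X : Matrix (Fin n) (Fin n) ℂ, (Wtilde X M).PosSemidef := by
  obtain ⟨X, hX, hW⟩ := exists_W_posDef hM
  exact ⟨X, Wtilde_posSemidef (posSemidef_of_W hM.2 hX hW.posSemidef) hW.posSemidef⟩

end KYP

/-! ### Compactness of the feasible set and attainment of the supremal shift -/

section Feasibility

variable {n m : ℕ}

/-- The pairs `(ξ, X)` with `ξ ∈ [0, 1]`, `X ≥ 0` and `W̃(X, M) - ξ diag(X, X, 2I) ≥ 0`. -/
def feasible (M : StateSpace n m) : Set (ℝ × Matrix (Fin n) (Fin n) ℂ) :=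
  {p | p.1 ∈ Set.Icc (0 : ℝ) 1 ∧ p.2.PosSemidef ∧
    (Wtilde p.2 M - (p.1 : ℂ) • weight m p.2).PosSemidef}

lemma isClosed_posSemidef (ι : Type*) [Fintype ι] :
    IsClosed {Y : Matrix ι ι ℂ | Y.PosSemidef} := by
  simp only [posSemidef_iff_dotProduct_mulVec, IsHermitian, Set.ofPred_and, Set.ofPred_forall]
  refine (isClosed_eq continuous_id.matrix_conjTranspose continuous_id).inter
    (isClosed_iInter fun v => isClosed_le continuous_const ?_)
  exact continuous_const.dotProduct (continuous_id.matrix_mulVec continuous_const)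

lemma continuous_Wtilde (M : StateSpace n m) :
    Continuous fun X : Matrix (Fin n) (Fin n) ℂ => Wtilde X M := by
  have hA : Continuous fun X : Matrix (Fin n) (Fin n) ℂ => X * M.A :=
    continuous_id.matrix_mul continuous_const
  have hB : Continuous fun X : Matrix (Fin n) (Fin n) ℂ => X * M.B :=
    continuous_id.matrix_mul continuous_const
  have hA' : Continuous fun X : Matrix (Fin n) (Fin n) ℂ => M.Aᴴ * X :=
    continuous_const.matrix_mul continuous_id
  have hB' : Continuous fun X : Matrix (Fin n) (Fin n) ℂ => M.Bᴴ * X :=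
    continuous_const.matrix_mul continuous_id
  refine Continuous.matrix_fromBlocks continuous_id ?_ ?_
    (Continuous.matrix_fromBlocks continuous_id continuous_const continuous_const continuous_const)
  · refine continuous_matrix ?_
    rintro i (j | j)
    · exact hA.matrix_elem i j
    · exact hB.matrix_elem i j
  · refine continuous_matrix ?_
    rintro (i | i) j
    · exact hA'.matrix_elem i j
    · exact hB'.matrix_elem i j

lemma isClosed_feasible (M : StateSpace n m) : IsClosed (feasible M) := by
  refine (isClosed_Icc.preimage continuous_fst).inter
    (((isClosed_posSemidef _).preimage continuous_snd).inter
      ((isClosed_posSemidef _).preimage ?_))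
  refine ((continuous_Wtilde M).comp continuous_snd).sub
    ((Complex.continuous_ofReal.comp continuous_fst).smul ?_)
  exact Continuous.matrix_fromBlocks continuous_snd continuous_const continuous_const
    (Continuous.matrix_fromBlocks continuous_snd continuous_const continuous_const continuous_const)

lemma Wtilde_posSemidef_of_sub {M : StateSpace n m} {X : Matrix (Fin n) (Fin n) ℂ} {ξ : ℝ}
    (hξ : 0 ≤ ξ) (hX : X.PosSemidef)
    (h : (Wtilde X M - (ξ : ℂ) • weight m X).PosSemidef) : (Wtilde X M).PosSemidef := by
  have := h.add ((weight_posSemidef (m := m) hX).smul (Complex.zero_le_real.2 hξ))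
  rwa [sub_add_cancel] at this

/-- Writing X as a Gram matrix and using AM–GM reduces bounds on all entries to bounds on the
diagonal. -/
lemma posSemidef_norm_apply_le {ι : Type*} [Fintype ι] {X : Matrix ι ι ℂ} (hX : X.PosSemidef)
    (i j : ι) : ‖X i j‖ ≤ (X i i).re + (X j j).re := by
  classical
  obtain ⟨G, rfl⟩ : ∃ G : Matrix ι ι ℂ, X = Gᴴ * G := by
    open scoped MatrixOrder in
    exact CStarAlgebra.nonneg_iff_eq_star_mul_self.1 hX.nonneg
  have hd : ∀ i, ((Gᴴ * G) i i).re = ∑ k, ‖G k i‖ ^ 2 := by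
    intro i
    simp only [mul_apply, conjTranspose_apply, Complex.re_sum]
    refine Finset.sum_congr rfl fun k _ => ?_
    rw [Complex.star_def, ← Complex.normSq_eq_conj_mul_self, Complex.normSq_eq_norm_sq,
      Complex.ofReal_re]
  rw [hd, hd, ← Finset.sum_add_distrib, mul_apply]
  refine (norm_sum_le _ _).trans (Finset.sum_le_sum fun k _ => ?_)
  rw [conjTranspose_apply, norm_mul, norm_star]
  nlinarith [sq_nonneg (‖G k i‖ - ‖G k j‖), sq_nonneg (‖G k i‖), sq_nonneg (‖G k j‖)]

/-- By controllability, the solutions of `W̃(X, M) ≥ 0` are bounded. -/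
lemma exists_bound {M : StateSpace n m} (hM : Controllable M.A M.B) :
    ∃ R : ℝ, ∀ X : Matrix (Fin n) (Fin n) ℂ, (Wtilde X M).PosSemidef → ∀ i j, ‖X i j‖ ≤ R := by
  -- Vectors on which the forms of all solutions are uniformly bounded. The parallelogram law gives
  -- sums, X ≥ AᴴXA gives invariance under A, and BᴴXB ≤ Dᴴ + D puts the range of B inside.
  let S : Submodule ℂ (Fin n → ℂ) :=
    { carrier := {v | ∃ c : ℝ, ∀ X : Matrix (Fin n) (Fin n) ℂ, (Wtilde X M).PosSemidef →
        star v ⬝ᵥ X *ᵥ v ≤ (c : ℂ)}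
      add_mem' := by
        rintro v w ⟨c, hc⟩ ⟨d, hd⟩
        refine ⟨2 * c + 2 * d, fun X hX => ?_⟩
        have h1 := (posSemidef_of_Wtilde hX).1.dotProduct_mulVec_nonneg (v - w)
        have h2 : star (v + w) ⬝ᵥ X *ᵥ (v + w) = 2 * (star v ⬝ᵥ X *ᵥ v) +
            2 * (star w ⬝ᵥ X *ᵥ w) - star (v - w) ⬝ᵥ X *ᵥ (v - w) := by
          simp only [star_add, star_sub, mulVec_add, mulVec_sub, add_dotProduct, sub_dotProduct,
            dotProduct_add, dotProduct_sub]
          ring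
        rw [h2]
        push_cast
        refine (sub_le_self _ h1).trans ?_
        have := hc X hX
        have := hd X hX
        gcongr
      zero_mem' := ⟨0, fun X _ => by simp⟩
      smul_mem' := by
        rintro a v ⟨c, hc⟩
        refine ⟨‖a‖ ^ 2 * c, fun X hX => ?_⟩
        have haa : star a * a = ((‖a‖ ^ 2 : ℝ) : ℂ) := by
          rw [Complex.star_def, ← Complex.normSq_eq_conj_mul_self, Complex.normSq_eq_norm_sq]
        rw [star_smul, mulVec_smul, smul_dotProduct, dotProduct_smul, smul_smul, haa, smul_eq_mul,
          Complex.ofReal_mul]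
        exact mul_le_mul_of_nonneg_left (hc X hX) (Complex.zero_le_real.2 (by positivity)) }
  have hS : S = ⊤ := by
    refine hM.eq_top (fun v hv => ?_) fun u => ?_
    · obtain ⟨c, hc⟩ := hv
      refine ⟨c, fun X hX => le_trans ?_ (hc X hX)⟩
      have h := (posSemidef_of_Wtilde hX).2.dotProduct_mulVec_nonneg (Sum.elim v 0)
      rw [W_form] at h
      simp only [mulVec_zero, add_zero, star_zero, zero_dotProduct, dotProduct_zero] at h
      exact sub_nonneg.1 h
    · refine ⟨(star u ⬝ᵥ M.D *ᵥ u + star (M.D *ᵥ u) ⬝ᵥ u).re, fun X hX => ?_⟩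
      have hW := (posSemidef_of_Wtilde hX).2
      have h := hW.dotProduct_mulVec_nonneg (Sum.elim 0 u)
      have hXB := (posSemidef_of_Wtilde hX).1.dotProduct_mulVec_nonneg (M.B *ᵥ u)
      rw [W_form] at h
      simp only [mulVec_zero, zero_add, star_zero, zero_dotProduct, zero_sub] at h
      rw [Complex.nonneg_iff] at h hXB
      rw [Complex.le_def]
      simp only [Complex.add_re, Complex.neg_re] at h
      simp only [Complex.ofReal_re, Complex.ofReal_im, Complex.add_re]
      exact ⟨by linarith [h.1], hXB.2.symm⟩
  have hc : ∀ i : Fin n, ∃ c : ℝ, ∀ X : Matrix (Fin n) (Fin n) ℂ, (Wtilde X M).PosSemidef →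
      (X i i).re ≤ c := by
    intro i
    obtain ⟨c, hc⟩ : (Pi.single i 1 : Fin n → ℂ) ∈ S := hS ▸ Submodule.mem_top
    refine ⟨c, fun X hX => ?_⟩
    have := hc X hX
    simp only [mulVec_single_one, ← Pi.single_star, star_one, single_one_dotProduct, col_apply]
      at this
    exact (Complex.le_def.1 this).1
  choose c hc using hc
  refine ⟨∑ i, |c i| + ∑ i, |c i|, fun X hX i j => ?_⟩
  have hle : ∀ i, (X i i).re ≤ ∑ i, |c i| := fun i => (hc i X hX).trans
    ((le_abs_self _).trans (Finset.single_le_sum (fun i _ => abs_nonneg (c i)) (Finset.mem_univ i)))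
  exact (posSemidef_norm_apply_le (posSemidef_of_Wtilde hX).1 i j).trans (add_le_add (hle i) (hle j))

/-- As ξ ≥ 0, the weight term can be dropped, so the bound for solutions of W̃(X, M) ≥ 0 applies
uniformly in ξ. -/
lemma isCompact_feasible {M : StateSpace n m} (hM : Controllable M.A M.B) :
    IsCompact (feasible M) := by
  obtain ⟨R, hR⟩ := exists_bound hM
  have hK : IsCompact {X : Matrix (Fin n) (Fin n) ℂ | ∀ i j, X i j ∈ Metric.closedBall (0 : ℂ) R} := by
    have h : IsCompact (Set.univ.pi fun _ : Fin n => Set.univ.pi fun _ : Fin n =>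
        Metric.closedBall (0 : ℂ) R) :=
      isCompact_univ_pi fun _ => isCompact_univ_pi fun _ => isCompact_closedBall 0 R
    have e : {X : Matrix (Fin n) (Fin n) ℂ | ∀ i j, X i j ∈ Metric.closedBall (0 : ℂ) R} =
        (Set.univ.pi fun _ : Fin n => Set.univ.pi fun _ : Fin n =>
          Metric.closedBall (0 : ℂ) R : Set (Fin n → Fin n → ℂ)) :=
      Set.ext fun X => ⟨fun h i _ j _ => h i j, fun h i j => h i trivial j trivial⟩
    rw [e]
    exact h
  refine ((isCompact_Icc (a := (0 : ℝ)) (b := 1)).prod hK).of_isClosed_subset (isClosed_feasible M) ?_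
  rintro ⟨ξ, X⟩ ⟨hξ, hX, hL⟩
  refine ⟨hξ, fun i j => ?_⟩
  rw [mem_closedBall_zero_iff]
  exact hR X (Wtilde_posSemidef_of_sub hξ.1 hX hL) i j

lemma shift_zero (M : StateSpace n m) : M.shift 0 = M := by
  ext <;> simp [shift]

lemma Wtilde_shift_posSemidef_iff {M : StateSpace n m} {X : Matrix (Fin n) (Fin n) ℂ} {ξ : ℝ}
    (hξ : ξ < 1) : (Wtilde X (M.shift ξ)).PosSemidef ↔
      (Wtilde X M - (ξ : ℂ) • weight m X).PosSemidef := by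
  have h0 : (0 : ℝ) < 1 - ξ := sub_pos.2 hξ
  have e : ((1 - ξ : ℝ) : ℂ) = 1 - ξ := by push_cast; rfl
  rw [← smul_Wtilde_shift M X hξ.ne, ← e]
  constructor
  · intro h
    exact h.smul (Complex.zero_le_real.2 h0.le)
  · intro h
    have := h.smul (Complex.zero_le_real.2 (inv_nonneg.2 h0.le))
    rwa [smul_smul, ← Complex.ofReal_mul, inv_mul_cancel₀ h0.ne', Complex.ofReal_one,
      one_smul] at this

lemma zero_mem_shifts {M : StateSpace n m} (hM : M.IsStrictlyPassive) :
    (0 : ℝ) ∈ {ξ : ℝ | ξ < 1 ∧ (M.shift ξ).IsStrictlyPassive} :=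
  ⟨one_pos, by rwa [shift_zero]⟩

lemma bddAbove_shifts (M : StateSpace n m) :
    BddAbove {ξ : ℝ | ξ < 1 ∧ (M.shift ξ).IsStrictlyPassive} :=
  ⟨1, fun _ h => h.1.le⟩

lemma maxShift_nonneg {M : StateSpace n m} (hM : M.IsStrictlyPassive) : 0 ≤ M.maxShift :=
  le_csSup (bddAbove_shifts M) (zero_mem_shifts hM)

/-- The linear matrix inequality is solvable at the supremal shift. -/
lemma exists_feasible_maxShift {M : StateSpace n m} (hmin : M.IsMinimal)
    (hpass : M.IsStrictlyPassive) :
    ∃ X : Matrix (Fin n) (Fin n) ℂ, (M.maxShift, X) ∈ feasible M := by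
  have hmem : ∀ ξ ∈ {ξ : ℝ | ξ < 1 ∧ (M.shift ξ).IsStrictlyPassive}, 0 ≤ ξ →
      ξ ∈ Prod.fst '' feasible M := by
    rintro ξ ⟨hξ1, hξ⟩ h0
    obtain ⟨X, hX⟩ := exists_Wtilde_posSemidef hξ
    exact ⟨(ξ, X), ⟨⟨h0, hξ1.le⟩, (posSemidef_of_Wtilde hX).1,
      (Wtilde_shift_posSemidef_iff hξ1).1 hX⟩, rfl⟩
  -- The half-line absorbs negative shifts, which `feasible` excludes. If the supremum falls there
  -- it equals 0, and the shift 0 is itself admissible.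
  have hclosed : IsClosed (Prod.fst '' feasible M ∪ Set.Iic (0 : ℝ)) :=
    ((isCompact_feasible hmin.1).image continuous_fst).isClosed.union isClosed_Iic
  have hsub : {ξ : ℝ | ξ < 1 ∧ (M.shift ξ).IsStrictlyPassive} ⊆
      Prod.fst '' feasible M ∪ Set.Iic (0 : ℝ) := by
    intro ξ hξ
    rcases le_total 0 ξ with h | h
    · exact Or.inl (hmem ξ hξ h)
    · exact Or.inr h
  have h := closure_minimal hsub hclosed
    (csSup_mem_closure ⟨0, zero_mem_shifts hpass⟩ (bddAbove_shifts M))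
  have h' : M.maxShift ∈ Prod.fst '' feasible M := by
    rcases h with h | h
    · exact h
    · have : M.maxShift = 0 := le_antisymm h (maxShift_nonneg hpass)
      rw [this]
      exact hmem 0 (zero_mem_shifts hpass) le_rfl
  obtain ⟨⟨ξ, X⟩, hX, rfl⟩ := h'
  exact ⟨X, hX⟩

lemma Wtilde_mulVec_middle (M : StateSpace n m) (X : Matrix (Fin n) (Fin n) ℂ) (y : Fin n → ℂ) :
    Wtilde X M *ᵥ Sum.elim 0 (Sum.elim y 0) =
      Sum.elim (X *ᵥ M.A *ᵥ y) (Sum.elim (X *ᵥ y) (M.C *ᵥ y)) := by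
  simp only [Wtilde, fromBlocks_mulVec, fromCols_mulVec, Sum.elim_comp_inl, Sum.elim_comp_inr,
    mulVec_zero, add_zero, zero_add, mulVec_mulVec]

lemma weight_mulVec_middle (X : Matrix (Fin n) (Fin n) ℂ) (y : Fin n → ℂ) :
    weight m X *ᵥ Sum.elim 0 (Sum.elim y 0) =
      Sum.elim (0 : Fin n → ℂ) (Sum.elim (X *ᵥ y) 0) := by
  simp only [weight, fromBlocks_mulVec, Sum.elim_comp_inl, Sum.elim_comp_inr,
    mulVec_zero, add_zero, zero_add, zero_mulVec]

/-- The matrix inequality at shift `1` forces `C = 0`. -/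
lemma feasible_ne_one (hn : 0 < n) {M : StateSpace n m} (hM : Controllable M.Aᴴ M.Cᴴ)
    {ξ : ℝ} {X : Matrix (Fin n) (Fin n) ℂ} (h : (ξ, X) ∈ feasible M) : ξ ≠ 1 := by
  intro hξ
  obtain ⟨-, -, hL⟩ := h
  simp only [hξ] at hL
  have hC : ∀ y : Fin n → ℂ, M.C *ᵥ y = 0 := by
    intro y
    -- At ξ = 1 the middle diagonal block X - ξX is zero, so (0, y, 0) is isotropic for a
    -- semidefinite matrix and lies in its kernel. The last block of the product is Cy.
    have e : (Wtilde X M - ((1 : ℝ) : ℂ) • weight m X) *ᵥ Sum.elim 0 (Sum.elim y 0) =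
        Sum.elim (X *ᵥ M.A *ᵥ y) (Sum.elim 0 (M.C *ᵥ y)) := by
      rw [sub_mulVec, smul_mulVec, Wtilde_mulVec_middle, weight_mulVec_middle]
      ext (i | i | i) <;> simp
    have h0 : star (Sum.elim (0 : Fin n → ℂ) (Sum.elim y (0 : Fin m → ℂ))) ⬝ᵥ
        (Wtilde X M - ((1 : ℝ) : ℂ) • weight m X) *ᵥ Sum.elim 0 (Sum.elim y 0) = 0 := by
      rw [e]
      simp [dotProduct]
    rw [hL.dotProduct_mulVec_zero_iff, e] at h0
    ext i
    exact congrFun h0 (Sum.inr (Sum.inr i))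
  have hbot := observable_eq_bot hM (S := ⊤) (fun _ _ => Submodule.mem_top) fun y _ => hC y
  have : (Pi.single ⟨0, hn⟩ 1 : Fin n → ℂ) ∈ (⊥ : Submodule ℂ (Fin n → ℂ)) :=
    hbot ▸ Submodule.mem_top
  have := congrFun ((Submodule.mem_bot ℂ).1 this) ⟨0, hn⟩
  simp at this

/-- By observability, every solution of `W̃(X, M) ≥ 0` is positive definite. -/
lemma posDef_of_Wtilde_posSemidef {M : StateSpace n m} (hM : Controllable M.Aᴴ M.Cᴴ)
    {X : Matrix (Fin n) (Fin n) ℂ} (h : (Wtilde X M).PosSemidef) : X.PosDef := by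
  have hX := (posSemidef_of_Wtilde h).1
  -- For y in ker X the vector (0, y, 0) is again isotropic, hence in the kernel. So ker X is an
  -- A-invariant subspace of ker C.
  have hker : ∀ y : Fin n → ℂ, X *ᵥ y = 0 → X *ᵥ M.A *ᵥ y = 0 ∧ M.C *ᵥ y = 0 := by
    intro y hy
    have h0 : star (Sum.elim (0 : Fin n → ℂ) (Sum.elim y (0 : Fin m → ℂ))) ⬝ᵥ
        Wtilde X M *ᵥ Sum.elim 0 (Sum.elim y 0) = 0 := by
      rw [Wtilde_mulVec_middle, hy]
      simp [dotProduct]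
    rw [h.dotProduct_mulVec_zero_iff, Wtilde_mulVec_middle] at h0
    exact ⟨funext fun i => congrFun h0 (Sum.inl i),
      funext fun i => congrFun h0 (Sum.inr (Sum.inr i))⟩
  have hbot := observable_eq_bot hM (S := LinearMap.ker X.mulVecLin)
    (fun y hy => (hker y hy).1) fun y hy => (hker y hy).2
  refine .of_dotProduct_mulVec_pos hX.1 fun v hv => lt_of_le_of_ne
    (hX.dotProduct_mulVec_nonneg v) fun h0 => hv ?_
  have : v ∈ LinearMap.ker X.mulVecLin := (hX.dotProduct_mulVec_zero_iff v).1 h0.symm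
  rwa [hbot, Submodule.mem_bot] at this

end Feasibility

/-! ### From a solution to a realization with large passivity radius -/

section Realizations

variable {n m : ℕ}

/-- Congruence by diag(T⁻¹, T⁻¹, I) also carries `weight m (Tᴴ * T)` to `weight m 1`, so the margin
ξ is preserved. -/
lemma transform_sub_weight_posSemidef {M : StateSpace n m} {T : Matrix (Fin n) (Fin n) ℂ}
    (hT : IsUnit T.det) {ξ : ℝ}
    (h : (Wtilde (Tᴴ * T) M - (ξ : ℂ) • weight m (Tᴴ * T)).PosSemidef) :
    (Wtilde 1 (M.transform T) - (ξ : ℂ) • weight m 1).PosSemidef := by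
  have hw : ((ξ : ℂ) • weight m (1 : Matrix (Fin n) (Fin n) ℂ)).IsHermitian := by
    rw [IsHermitian, conjTranspose_smul, (weight_posSemidef PosSemidef.one).1.eq]
    simp
  refine .of_dotProduct_mulVec_nonneg ((Wtilde_isHermitian _ isHermitian_one).sub hw) fun w => ?_
  obtain ⟨x, y, u, rfl⟩ : ∃ x y u, w = Sum.elim x (Sum.elim y u) :=
    ⟨w ∘ Sum.inl, (w ∘ Sum.inr) ∘ Sum.inl, (w ∘ Sum.inr) ∘ Sum.inr, by simp⟩
  have hinv : ∀ x : Fin n → ℂ, T *ᵥ T⁻¹ *ᵥ x = x := fun x => by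
    rw [mulVec_mulVec, mul_nonsing_inv _ hT, one_mulVec]
  have h1 := h.dotProduct_mulVec_nonneg (Sum.elim (T⁻¹ *ᵥ x) (Sum.elim (T⁻¹ *ᵥ y) u))
  rw [sub_mulVec, dotProduct_sub, smul_mulVec, dotProduct_smul, weight_form,
    Wtilde_transform_form M hT] at h1
  simp only [← mulVec_mulVec, dotProduct_conjTranspose_mulVec, hinv] at h1
  rw [sub_mulVec, dotProduct_sub, smul_mulVec, dotProduct_smul, weight_form, one_mulVec,
    one_mulVec]
  exact h1

lemma perturb_zero (M : StateSpace n m) : M.perturb 0 = M := by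
  ext <;> simp [perturb, toBlocks₁₁, toBlocks₁₂, toBlocks₂₁, toBlocks₂₂]

lemma PerturbationNorm.size_zero (ν : PerturbationNorm) :
    ν.size (0 : Matrix (Fin n ⊕ Fin m) (Fin n ⊕ Fin m) ℂ) = 0 := by
  cases ν <;> simp [PerturbationNorm.size]

lemma le_passivityRadius {M : StateSpace n m} {ξ : ℝ}
    (h : (Wtilde 1 M - (ξ : ℂ) • weight m 1).PosSemidef) (ν : PerturbationNorm) :
    ENNReal.ofReal ξ ≤ M.passivityRadius ν := by
  rcases le_or_gt ξ 0 with hξ | hξ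
  · rw [ENNReal.ofReal_of_nonpos hξ]
    exact zero_le
  -- The case Δ = 0 of the perturbation bound, which needs ξ > 0. The identity is then an admissible
  -- X in the supremum.
  have hW : (W 1 M).PosDef := by
    have := Wtilde_perturb_posDef h ν (Δ := 0) (by rwa [ν.size_zero])
    rw [perturb_zero] at this
    exact (posDef_of_Wtilde this).2
  refine le_iSup₂_of_le 1 ⟨PosDef.one, hW⟩ (le_iInf₂ fun Δ hΔ => ?_)
  refine ENNReal.ofReal_le_ofReal (not_lt.1 fun hlt => ?_)
  exact (posDef_of_Wtilde (Wtilde_perturb_posDef h ν hlt)).2.det_pos.ne' hΔ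

end Realizations

end StateSpace

theorem mainTheorem1 {n m : ℕ} (hn : 0 < n) (M : StateSpace n m)
    (hmin : M.IsMinimal) (hpass : M.IsStrictlyPassive) :
    -- the supremum is below 1, so the shifted model at `Ξ` is well defined
    M.maxShift < 1 ∧
    -- lower bound for the supremal passivity radius over all realizations
    (∀ ν : StateSpace.PerturbationNorm,
      ENNReal.ofReal M.maxShift ≤
        ⨆ (k : ℕ) (N : StateSpace k m) (_ : N.SameTransfer M), N.passivityRadius ν) ∧
    -- the inequality `W̃(X, M_Ξ) ≥ 0` has a positive definite solution
    (∃ X : Matrix (Fin n) (Fin n) ℂ,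
      X.PosDef ∧ (StateSpace.Wtilde X (M.shift M.maxShift)).PosSemidef) ∧
    -- every solution yields normalized realizations with passivity radius at least `Ξ`
    (∀ X T : Matrix (Fin n) (Fin n) ℂ, X.PosDef →
      (StateSpace.Wtilde X (M.shift M.maxShift)).PosSemidef → X = Tᴴ * T →
      (M.transform T).IsNormalized ∧ (M.transform T).IsMinimal ∧
      (M.transform T).SameTransfer M ∧
      ∀ ν : StateSpace.PerturbationNorm,
        ENNReal.ofReal M.maxShift ≤ (M.transform T).passivityRadius ν ∧
        ∀ Δ : Matrix (Fin n ⊕ Fin m) (Fin n ⊕ Fin m) ℂ, ν.size Δ < M.maxShift →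
          ((M.transform T).perturb Δ).IsStrictlyPassive) := by
  have hnonneg := StateSpace.maxShift_nonneg hpass
  obtain ⟨X₀, hX₀⟩ := StateSpace.exists_feasible_maxShift hmin hpass
  have hlt : M.maxShift < 1 :=
    lt_of_le_of_ne hX₀.1.2 (StateSpace.feasible_ne_one hn hmin.2 hX₀)
  have hX₀pos : X₀.PosDef := StateSpace.posDef_of_Wtilde_posSemidef hmin.2
    (StateSpace.Wtilde_posSemidef_of_sub hnonneg hX₀.2.1 hX₀.2.2)
  -- T need not be Hermitian or triangular: definiteness of TᴴT alone makes it invertible.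
  have hdet : ∀ T : Matrix (Fin n) (Fin n) ℂ, (Tᴴ * T).PosDef → IsUnit T.det := by
    intro T hT
    have h := hT.det_pos.ne'
    rw [Matrix.det_mul] at h
    exact isUnit_iff_ne_zero.2 (right_ne_zero_of_mul h)
  refine ⟨hlt, fun ν => ?_, ⟨X₀, hX₀pos, (StateSpace.Wtilde_shift_posSemidef_iff hlt).2 hX₀.2.2⟩,
    ?_⟩
  · obtain ⟨T, rfl⟩ : ∃ T : Matrix (Fin n) (Fin n) ℂ, X₀ = Tᴴ * T := by
      open scoped MatrixOrder in
      exact CStarAlgebra.nonneg_iff_eq_star_mul_self.1 hX₀.2.1.nonneg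
    have hT := hdet T hX₀pos
    exact (StateSpace.le_passivityRadius
      (StateSpace.transform_sub_weight_posSemidef hT hX₀.2.2) ν).trans
      (le_iSup_of_le n (le_iSup₂_of_le (M.transform T)
        (fun z _ _ => StateSpace.transfer_transform M hT z) le_rfl))
  · rintro X T hX hW rfl
    have hT := hdet T hX
    have hL := StateSpace.transform_sub_weight_posSemidef hT
      ((StateSpace.Wtilde_shift_posSemidef_iff hlt).1 hW)
    refine ⟨StateSpace.isNormalized_of_W (StateSpace.posSemidef_of_Wtilde
      (StateSpace.Wtilde_posSemidef_of_sub hnonneg Matrix.PosSemidef.one hL)).2,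
      StateSpace.isMinimal_transform hmin hT,
      fun z _ _ => StateSpace.transfer_transform M hT z,
      fun ν => ⟨StateSpace.le_passivityRadius hL ν, fun Δ hΔ => ?_⟩⟩
    obtain ⟨h1, h2⟩ := StateSpace.posDef_of_Wtilde (StateSpace.Wtilde_perturb_posDef hL ν hΔ)
    exact StateSpace.isStrictlyPassive_of_W h1 h2
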